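/- Let $\Bbbk$ be an algebraically closed field of characteristic $0$ and let $X$ be a smooth variety over $\Bbbk$, i.e. an integral separated scheme of finite type, smooth over $\Bbbk$. Let $\Theta$ be its tangent sheaf, the sheaf of $\Bbbk$-linear derivations of $\mathcal O_X$, with $\Gamma(U,\Theta)=\mathrm{Der}_{\Bbbk}(\Gamma(U,\mathcal O_X))$ for $U$ affine open. Let $\mathcal F$ be a coherent (quasi-coherent of finite type) sheaf of $\mathcal O_X$-modules with the structure of an infinitesimally equivariant (infeq) sheaf: for every open $U\subseteq X$, the space $\Gamma(U,\mathcal F)$ is a module over the $\Bbbk$-Lie algebra $\Gamma(U,\Theta)$ such that $$\eta\cdot(f\cdot m)=\eta(f)\cdot m+f\cdot(\eta\cdot m)\qquad(\eta\in\Gamma(U,\Theta),\ f\in\Gamma(U,\mathcal O_X),\ m\in\Gamma(U,\mathcal F)),$$ and these actions are compatible with restriction to smaller open sets. Let $\mathrm{At}(\mathcal F)$ be the Atiyah algebra of $\mathcal F$: its sections over $U$ are the pairs $(\eta,P)$ of a vector field $\eta\in\Gamma(U,\Theta)$ and a $\Bbbk$-linear endomorphism $P$ of the sheaf $\mathcal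 F|_U$ with $P(fm)=\eta(f)m+fP(m)$ for all local sections $f$ of $\mathcal O_X|_U$ and $m$ of $\mathcal F|_U$; it is a sheaf of $\mathcal O_X$-modules through $f(\eta,P)=(f\eta,fP)$. Let $L:\Theta\to\mathrm{At}(\mathcal F)$ be the Lie map, which sends $\eta$ to $(\eta,\ m\mapsto\eta\cdot m)$. Let $\mathrm{rank}(\mathcal F)$ be the dimension of the stalk of $\mathcal F$ at the generic point of $X$ over the function field of $X$. Then $L$ is a differential operator of order at most $n=\mathrm{rank}(\mathcal F)^2$ between sheaves of $\mathcal O_X$-modules: for every open $U\subseteq X$ and all $f_0,\dots,f_n\in\Gamma(U,\mathcal O_X)$, the iterated commutator $[\dots[[L,f_0],f_1],\dots,f_n]$ with the multiplications by the $f_i$ vanishes on $\Gamma(U,\Theta)$. -/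

import Mathlib

open CategoryTheory Opposite AlgebraicGeometry

universe u

noncomputable section

namespace Infeq

/-! ## Differential operators between modules -/

section DiffOp

variable {k : Type*} [CommRing k] (A : Type*) [CommRing A] [Algebra k A]
  {M N : Type*} [AddCommGroup M] [Module k M] [Module A M] [IsScalarTower k A M]
  [AddCommGroup N] [Module k N] [Module A N] [IsScalarTower k A N]

variable {A} in
/-- The commutator `[T, a] = T ∘ a - a ∘ T` of a `k`-linear map with multiplication by `a`. -/
def commutator (T : M →ₗ[k] N) (a : A) : M →ₗ[k] N :=
  T ∘ₗ Algebra.lsmul k k M a - Algebra.lsmul k k N a ∘ₗ T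

/-- Grothendieck's `k`-linear differential operators of order at most `n` between `A`-modules:
those of order at most `0` are the `A`-linear maps, and `T` has order at most `n + 1` if all
commutators `[T, a]` with `a : A` have order at most `n`. -/
def IsDiffOp : ℕ → (M →ₗ[k] N) → Prop
  | 0, T => ∀ (a : A) (m : M), T (a • m) = a • T m
  | n + 1, T => ∀ a : A, IsDiffOp n (commutator T a)

end DiffOp

/-! ## Schemes over a field: sections are modules over the ground field -/

section Scheme

variable {k : Type u} [Field k] {X : Scheme.{u}} [X.Over (Spec (.of k))]

/-- The `k`-algebra structure on the sections of the structure sheaf of a `k`-scheme. -/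
instance algebraSections (U : X.Opens) : Algebra k Γ(X, U) :=
  ((Scheme.ΓSpecIso (.of k)).inv ≫ (X ↘ Spec (.of k)).appTop ≫
    X.presheaf.map (homOfLE le_top).op).hom.toAlgebra

/-- Restriction of functions from `V` to a smaller open `W`, as a `k`-algebra map. -/
def resO {W V : X.Opens} (h : W ≤ V) : Γ(X, V) →ₐ[k] Γ(X, W) where
  __ := (X.presheaf.map (homOfLE h).op).hom
  commutes' c := by
    change ((Scheme.ΓSpecIso (.of k)).inv ≫ (X ↘ Spec (.of k)).appTop ≫
      X.presheaf.map (homOfLE le_top).op ≫ X.presheaf.map (homOfLE h).op).hom c = _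
    rw [← Functor.map_comp]
    rfl

lemma resO_trans {W V U : X.Opens} (h : W ≤ V) (h' : V ≤ U) (a : Γ(X, U)) :
    resO (k := k) (h.trans h') a = resO (k := k) h (resO (k := k) h' a) := by
  change (X.presheaf.map (homOfLE (h.trans h')).op) a =
    (X.presheaf.map (homOfLE h').op ≫ X.presheaf.map (homOfLE h).op) a
  rw [← Functor.map_comp]
  rfl

/-- The `k`-vector space structure on the sections of a sheaf of modules on a `k`-scheme. -/
instance moduleSections (F : X.Modules) (U : X.Opens) : Module k Γ(F, U) :=
  Module.compHom _ (algebraMap k Γ(X, U))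

instance (F : X.Modules) (U : X.Opens) : IsScalarTower k Γ(X, U) Γ(F, U) :=
  IsScalarTower.of_compHom _ _ _

/-- Restriction of sections of a sheaf of modules from `V` to a smaller open `W`. -/
def resM (F : X.Modules) {W V : X.Opens} (h : W ≤ V) : Γ(F, V) →+ Γ(F, W) :=
  (F.presheaf.map (homOfLE h).op).hom

variable (k) in
lemma resM_smul (F : X.Modules) {W V : X.Opens} (h : W ≤ V) (a : Γ(X, V)) (m : Γ(F, V)) :
    resM F h (a • m) = resO (k := k) h a • resM F h m :=
  F.map_smul (homOfLE h) a m

/-- The `𝒪_{X,x}`-module structure on the stalk of a sheaf of modules at a point `x`. -/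
instance moduleStalk {X : Scheme.{u}} (F : X.Modules) (x : X) :
    Module (X.presheaf.stalk x) (F.presheaf.stalk x) :=
  PresheafOfModules.instModuleCarrierStalkCommRingCatCarrierAbPresheafOpensCarrier
    (R := X.presheaf) F.val x

/-- The rank of a sheaf of modules on an integral scheme: the dimension of its stalk at the
generic point over the function field. -/
def rank {X : Scheme.{u}} [IsIntegral X] (F : X.Modules) : ℕ :=
  Module.finrank X.functionField (F.presheaf.stalk (genericPoint X))

end Scheme

/-! ## The tangent sheaf -/

section Tangent

variable (k : Type u) [Field k] (X : Scheme.{u}) [X.Over (Spec (.of k))]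

/-- The sections over `U` of the tangent sheaf `Θ` of `X` over `k`: the `k`-linear derivations of
the sheaf of rings `𝒪_X|_U`, i.e. families of `k`-derivations of the rings `Γ(X, V)`, `V ≤ U`,
compatible with restriction. -/
@[ext]
structure Tangent (U : X.Opens) where
  /-- the derivation of the functions on a smaller open set -/
  app (V : X.Opens) (hV : V ≤ U) : Derivation k Γ(X, V) Γ(X, V)
  app_res {V W : X.Opens} (hV : V ≤ U) (hW : W ≤ V) (a : Γ(X, V)) :
    app W (hW.trans hV) (resO (k := k) hW a) = resO (k := k) hW (app V hV a)

namespace Tangent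

variable {k X} {U : X.Opens}

instance : Zero (Tangent k X U) := ⟨⟨fun _ _ => 0, by intro V W hV hW a; simp⟩⟩
instance : Add (Tangent k X U) :=
  ⟨fun D E => ⟨fun V h => D.app V h + E.app V h, by intro V W hV hW a; simp [D.app_res hV hW, E.app_res hV hW]⟩⟩
instance : Neg (Tangent k X U) :=
  ⟨fun D => ⟨fun V h => -D.app V h, by intro V W hV hW a; simp [D.app_res hV hW]⟩⟩
instance : Sub (Tangent k X U) :=
  ⟨fun D E => ⟨fun V h => D.app V h - E.app V h, by intro V W hV hW a; simp [D.app_res hV hW, E.app_res hV hW]⟩⟩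
instance : SMul Γ(X, U) (Tangent k X U) :=
  ⟨fun a D => ⟨fun V h => resO (k := k) h a • D.app V h, by
    intro V W hV hW b
    simp only [Derivation.smul_apply, smul_eq_mul, map_mul, D.app_res hV hW]
    rw [← resO_trans]⟩⟩
instance : Bracket (Tangent k X U) (Tangent k X U) :=
  ⟨fun D E => ⟨fun V h => ⁅D.app V h, E.app V h⁆, by
    intro V W hV hW a; simp [Derivation.commutator_apply, D.app_res hV hW, E.app_res hV hW]⟩⟩

@[simp] lemma zero_app (V : X.Opens) (h : V ≤ U) : (0 : Tangent k X U).app V h = 0 := rfl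
@[simp] lemma add_app (D E : Tangent k X U) (V : X.Opens) (h : V ≤ U) :
    (D + E).app V h = D.app V h + E.app V h := rfl
@[simp] lemma neg_app (D : Tangent k X U) (V : X.Opens) (h : V ≤ U) :
    (-D).app V h = -D.app V h := rfl
@[simp] lemma sub_app (D E : Tangent k X U) (V : X.Opens) (h : V ≤ U) :
    (D - E).app V h = D.app V h - E.app V h := rfl
@[simp] lemma smul_app (a : Γ(X, U)) (D : Tangent k X U) (V : X.Opens) (h : V ≤ U) :
    (a • D).app V h = resO (k := k) h a • D.app V h := rfl
@[simp] lemma lie_app (D E : Tangent k X U) (V : X.Opens) (h : V ≤ U) :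
    ⁅D, E⁆.app V h = ⁅D.app V h, E.app V h⁆ := rfl

instance : AddCommGroup (Tangent k X U) where
  add_assoc _ _ _ := by ext; simp [add_assoc]
  zero_add _ := by ext; simp
  add_zero _ := by ext; simp
  add_comm _ _ := by ext; simp [add_comm]
  neg_add_cancel _ := by ext; simp
  sub_eq_add_neg _ _ := by ext; simp [sub_eq_add_neg]
  nsmul := nsmulRec
  zsmul := zsmulRec

instance : Module Γ(X, U) (Tangent k X U) where
  one_smul _ := by ext; simp
  mul_smul _ _ _ := by ext; simp [mul_assoc]
  smul_zero _ := by ext; simp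
  smul_add _ _ _ := by ext; simp
  add_smul _ _ _ := by ext; simp [add_mul]
  zero_smul _ := by ext; simp

instance : Module k (Tangent k X U) := Module.compHom _ (algebraMap k Γ(X, U))

instance : IsScalarTower k Γ(X, U) (Tangent k X U) := IsScalarTower.of_compHom _ _ _

@[simp] lemma const_smul_app (c : k) (D : Tangent k X U) (V : X.Opens) (h : V ≤ U) :
    (c • D).app V h = c • D.app V h := by
  change resO (k := k) h (algebraMap k Γ(X, U) c) • D.app V h = _
  rw [AlgHom.commutes, algebraMap_smul]

instance : LieRing (Tangent k X U) where
  add_lie _ _ _ := by ext1; funext V h; simp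
  lie_add _ _ _ := by ext1; funext V h; simp
  lie_self _ := by ext1; funext V h; simp
  leibniz_lie _ _ _ := by ext1; funext V h; simp

instance : LieAlgebra k (Tangent k X U) where
  lie_smul c D E := by
    ext1; funext V h; ext a
    simp [Derivation.commutator_apply, smul_sub]

/-- Restriction of vector fields to a smaller open set. -/
def res {W : X.Opens} (h : W ≤ U) (D : Tangent k X U) : Tangent k X W :=
  ⟨fun V hV => D.app V (hV.trans h), fun hV hW a => D.app_res (hV.trans h) hW a⟩

/-- A vector field on `U` as a derivation of the ring of functions on `U`. -/
def deriv (D : Tangent k X U) : Derivation k Γ(X, U) Γ(X, U) := D.app U le_rfl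

end Tangent

end Tangent

/-! ## The Atiyah algebra of a sheaf of modules -/

section Atiyah

variable (k : Type u) [Field k] {X : Scheme.{u}} [X.Over (Spec (.of k))] (F : X.Modules)

/-- The sections over `U` of the Atiyah algebra `At(F)`: a vector field `D` on `U` together with a
`k`-linear endomorphism `P` of the sheaf `F|_U` such that `P (a • m) = D a • m + a • P m`. The last
condition says that all commutators `[P, a]` are `𝒪`-linear, i.e. that `P` is a differential
operator of order at most one, and that the symbol `a ↦ [P, a]` of `P` is `D ⊗ id`. -/
@[ext]
structure Atiyah (U : X.Opens) where
  /-- the anchor, i.e. the symbol -/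
  anchor : Tangent k X U
  /-- the endomorphism, on the sections over a smaller open set -/
  app (V : X.Opens) (hV : V ≤ U) : Γ(F, V) →ₗ[k] Γ(F, V)
  app_res {V W : X.Opens} (hV : V ≤ U) (hW : W ≤ V) (m : Γ(F, V)) :
    app W (hW.trans hV) (resM F hW m) = resM F hW (app V hV m)
  leibniz (V : X.Opens) (hV : V ≤ U) (a : Γ(X, V)) (m : Γ(F, V)) :
    app V hV (a • m) = anchor.app V hV a • m + a • app V hV m

namespace Atiyah

variable {k F} {U : X.Opens}

instance : Zero (Atiyah k F U) := ⟨⟨0, fun _ _ => 0, by intros; simp, by intros; simp⟩⟩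
instance : Add (Atiyah k F U) :=
  ⟨fun P Q => ⟨P.anchor + Q.anchor, fun V h => P.app V h + Q.app V h,
    by intro V W hV hW m; simp [P.app_res hV hW, Q.app_res hV hW],
    by intros; simp [P.leibniz, Q.leibniz, add_smul]; abel⟩⟩
instance : Neg (Atiyah k F U) :=
  ⟨fun P => ⟨-P.anchor, fun V h => -P.app V h, by intro V W hV hW m; simp [P.app_res hV hW],
    by intros; simp [P.leibniz]; abel⟩⟩
instance : Sub (Atiyah k F U) :=
  ⟨fun P Q => ⟨P.anchor - Q.anchor, fun V h => P.app V h - Q.app V h,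
    by intro V W hV hW m; simp [P.app_res hV hW, Q.app_res hV hW],
    by intros; simp [P.leibniz, Q.leibniz, sub_smul, smul_sub]; abel⟩⟩
instance : SMul Γ(X, U) (Atiyah k F U) :=
  ⟨fun a P => ⟨a • P.anchor, fun V h => Algebra.lsmul k k Γ(F, V) (resO (k := k) h a) ∘ₗ P.app V h,
    by
      intro V W hV hW m
      simp only [LinearMap.comp_apply, Algebra.lsmul_coe, P.app_res hV hW, resM_smul k]
      rw [← resO_trans],
    by
      intro V hV b m
      simp only [LinearMap.comp_apply, Algebra.lsmul_coe, P.leibniz, smul_add, Tangent.smul_app,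
        Derivation.smul_apply, smul_eq_mul, mul_smul]
      rw [smul_comm b]⟩⟩
instance : Bracket (Atiyah k F U) (Atiyah k F U) :=
  ⟨fun P Q => ⟨⁅P.anchor, Q.anchor⁆, fun V h => P.app V h ∘ₗ Q.app V h - Q.app V h ∘ₗ P.app V h,
    by intro V W hV hW m; simp [P.app_res hV hW, Q.app_res hV hW],
    by
      intros
      simp [P.leibniz, Q.leibniz, Derivation.commutator_apply, sub_smul, smul_sub]
      abel⟩⟩

@[simp] lemma zero_anchor : (0 : Atiyah k F U).anchor = 0 := rfl
@[simp] lemma add_anchor (P Q : Atiyah k F U) : (P + Q).anchor = P.anchor + Q.anchor := rfl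
@[simp] lemma neg_anchor (P : Atiyah k F U) : (-P).anchor = -P.anchor := rfl
@[simp] lemma sub_anchor (P Q : Atiyah k F U) : (P - Q).anchor = P.anchor - Q.anchor := rfl
@[simp] lemma smul_anchor (a : Γ(X, U)) (P : Atiyah k F U) : (a • P).anchor = a • P.anchor := rfl
@[simp] lemma lie_anchor (P Q : Atiyah k F U) : ⁅P, Q⁆.anchor = ⁅P.anchor, Q.anchor⁆ := rfl
@[simp] lemma zero_app (V : X.Opens) (h : V ≤ U) : (0 : Atiyah k F U).app V h = 0 := rfl
@[simp] lemma add_app (P Q : Atiyah k F U) (V : X.Opens) (h : V ≤ U) :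
    (P + Q).app V h = P.app V h + Q.app V h := rfl
@[simp] lemma neg_app (P : Atiyah k F U) (V : X.Opens) (h : V ≤ U) :
    (-P).app V h = -P.app V h := rfl
@[simp] lemma sub_app (P Q : Atiyah k F U) (V : X.Opens) (h : V ≤ U) :
    (P - Q).app V h = P.app V h - Q.app V h := rfl
@[simp] lemma smul_app (a : Γ(X, U)) (P : Atiyah k F U) (V : X.Opens) (h : V ≤ U) (m : Γ(F, V)) :
    (a • P).app V h m = resO (k := k) h a • P.app V h m := rfl
@[simp] lemma lie_app (P Q : Atiyah k F U) (V : X.Opens) (h : V ≤ U) (m : Γ(F, V)) :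
    ⁅P, Q⁆.app V h m = P.app V h (Q.app V h m) - Q.app V h (P.app V h m) := rfl

lemma ext' {P Q : Atiyah k F U} (h₁ : P.anchor = Q.anchor)
    (h₂ : ∀ (V : X.Opens) (h : V ≤ U) (m : Γ(F, V)), P.app V h m = Q.app V h m) : P = Q :=
  Atiyah.ext h₁ (by funext V h; exact LinearMap.ext (h₂ V h))

instance : AddCommGroup (Atiyah k F U) where
  add_assoc _ _ _ := ext' (add_assoc _ _ _) (by intros; simp [add_assoc])
  zero_add _ := ext' (zero_add _) (by intros; simp)
  add_zero _ := ext' (add_zero _) (by intros; simp)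
  add_comm _ _ := ext' (add_comm _ _) (by intros; simp [add_comm])
  neg_add_cancel _ := ext' (neg_add_cancel _) (by intros; simp)
  sub_eq_add_neg _ _ := ext' (sub_eq_add_neg _ _) (by intros; simp [sub_eq_add_neg])
  nsmul := nsmulRec
  zsmul := zsmulRec

instance : Module Γ(X, U) (Atiyah k F U) where
  one_smul _ := ext' (one_smul _ _) (by intros; simp)
  mul_smul _ _ _ := ext' (mul_smul _ _ _) (by intros; simp [mul_smul])
  smul_zero _ := ext' (smul_zero _) (by intros; simp)
  smul_add _ _ _ := ext' (smul_add _ _ _) (by intros; simp)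
  add_smul _ _ _ := ext' (add_smul _ _ _) (by intros; simp [add_smul])
  zero_smul _ := ext' (zero_smul _ _) (by intros; simp)

instance : Module k (Atiyah k F U) := Module.compHom _ (algebraMap k Γ(X, U))

instance : IsScalarTower k Γ(X, U) (Atiyah k F U) := IsScalarTower.of_compHom _ _ _

@[simp] lemma const_smul_anchor (c : k) (P : Atiyah k F U) : (c • P).anchor = c • P.anchor := rfl

@[simp] lemma const_smul_app (c : k) (P : Atiyah k F U) (V : X.Opens) (h : V ≤ U)
    (m : Γ(F, V)) : (c • P).app V h m = c • P.app V h m := by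
  change resO (k := k) h (algebraMap k Γ(X, U) c) • P.app V h m = _
  rw [AlgHom.commutes, algebraMap_smul]

instance : LieRing (Atiyah k F U) where
  add_lie _ _ _ := ext' (add_lie _ _ _) (by intros; simp; abel)
  lie_add _ _ _ := ext' (lie_add _ _ _) (by intros; simp; abel)
  lie_self _ := ext' (lie_self _) (by intros; simp)
  leibniz_lie _ _ _ := ext' (leibniz_lie _ _ _) (by intros; simp; abel)

instance : LieAlgebra k (Atiyah k F U) where
  lie_smul c P Q := ext' (lie_smul c P.anchor Q.anchor) (by intros; simp [smul_sub])

/-- Restriction of sections of the Atiyah algebra to a smaller open set. -/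
def res {W : X.Opens} (h : W ≤ U) (P : Atiyah k F U) : Atiyah k F W :=
  ⟨P.anchor.res h, fun V hV => P.app V (hV.trans h), fun hV hW m => P.app_res (hV.trans h) hW m,
    fun V hV a m => P.leibniz V (hV.trans h) a m⟩

end Atiyah

end Atiyah

/-! ## Infinitesimally equivariant sheaves and the Lie map -/

section Infeq

variable (k : Type u) [Field k] {X : Scheme.{u}} [X.Over (Spec (.of k))] (F : X.Modules)

/-- The structure of an infinitesimally equivariant (infeq) sheaf on the sheaf of modules `F`:
an action of the sheaf of `k`-Lie algebras `Θ` on the sheaf `F`, satisfying the Leibniz rule. -/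
structure InfeqStructure where
  /-- the action of vector fields on sections -/
  act (U : X.Opens) : Tangent k X U →ₗ[k] Γ(F, U) →ₗ[k] Γ(F, U)
  act_lie (U : X.Opens) (D E : Tangent k X U) (m : Γ(F, U)) :
    act U ⁅D, E⁆ m = act U D (act U E m) - act U E (act U D m)
  leibniz (U : X.Opens) (D : Tangent k X U) (a : Γ(X, U)) (m : Γ(F, U)) :
    act U D (a • m) = D.deriv a • m + a • act U D m
  act_res {V U : X.Opens} (h : V ≤ U) (D : Tangent k X U) (m : Γ(F, U)) :
    act V (D.res h) (resM F h m) = resM F h (act U D m)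

namespace InfeqStructure

variable {k F} (S : InfeqStructure k F)

/-- The Lie map `L : Θ → At(F)` of an infeq sheaf on the sections over `U`: it sends a vector field
`D` to the endomorphism `m ↦ D m` of `F|_U`, with symbol `D`. It is a homomorphism of `k`-Lie
algebras, in general not `𝒪`-linear. -/
def lieMap (U : X.Opens) : Tangent k X U →ₗ⁅k⁆ Atiyah k F U where
  toFun D :=
    { anchor := D
      app := fun V h => S.act V (D.res h)
      app_res := fun hV hW m => S.act_res hW (D.res hV) m
      leibniz := fun V hV a m => S.leibniz V (D.res hV) a m }
  map_add' D E := Atiyah.ext' rfl fun V h m => by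
    change S.act V (D.res h + E.res h) m = _
    rw [map_add]; rfl
  map_smul' c D := Atiyah.ext' rfl fun V h m => by
    have : (c • D).res h = c • D.res h := by
      ext1; funext W hW
      change (c • D).app W _ = (c • D.res h).app W hW
      rw [Tangent.const_smul_app, Tangent.const_smul_app]; rfl
    change S.act V ((c • D).res h) m = _
    rw [this, map_smul, RingHom.id_apply, Atiyah.const_smul_app]; rfl
  map_lie' {D E} := Atiyah.ext' rfl fun V h m => S.act_lie V (D.res h) (E.res h) m

/-- The Lie map is a splitting of the symbol. -/
lemma anchor_lieMap (U : X.Opens) (D : Tangent k X U) : (S.lieMap U D).anchor = D := rfl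

/-- The Lie map is a morphism of sheaves. -/
lemma lieMap_res {V U : X.Opens} (h : V ≤ U) (D : Tangent k X U) :
    S.lieMap V (D.res h) = (S.lieMap U D).res h := rfl

/-- The Lie map is a differential operator of order at most `n` between the sheaves of
`𝒪_X`-modules `Θ` and `At(F)`: over every open set, all `(n + 1)`-fold commutators with functions
vanish. -/
def LieMapIsDiffOp (n : ℕ) : Prop :=
  ∀ U : X.Opens, IsDiffOp (A := Γ(X, U)) n (S.lieMap U : Tangent k X U →ₗ[k] Atiyah k F U)

end InfeqStructure

end Infeq

end Infeq

end

noncomputable section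

namespace Infeq

/-! ### Finite-dimensional representations of Witt-type operators -/

section WittIdeals

/-! Let `K` be the function field, `M` the generic stalk of `F`, `r` its dimension and `N = r² + 1`.
For a vector field `D` on `U`, let ρ(a) be the operator by which `a D` acts on `M`, and let Ψ(c ⊗ a)
= c ρ(a) be its `K`-linear extension to `K ⊗ Γ(X, U)`. Commuting the Lie map with `f` amounts to
multiplying the argument of Ψ by `1 ⊗ f - f ⊗ 1`. On `M`, the `N`-fold commutator at `D` is
therefore Ψ of a product of `N` such differences, and this has to vanish.

By polarization (`map_diag_prod_eq_zero`) it is enough to treat powers `t ^ N` with `t = 1 ⊗ f - f ⊗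
1`, and only for `f` with `D f ≠ 0`. Shrinking `U` and rescaling `D` makes `D f = 1`. On the kernel
of the multiplication `K ⊗ A → K`, Ψ has `K`-linear values and sends `b D c - c D b` to a
commutator. So the `e m = Ψ(t ^ m)`, `m ≥ 1`, satisfy the Witt relations `[e a, e m] = (m - a) e (a
+ m - 1)`. For `m ≥ 2` the nonzero `e m` are eigenvectors of `ad (e 1)` with distinct nonzero
eigenvalues, hence independent together with the identity in the `r²`-dimensional algebra `End M`.
This forces `e m = 0` for `m ≥ N` (`witt_eq_zero`), and further brackets spread the vanishing to all
multiples of `t ^ N` (`map_pow_mul_eq_zero`).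

Returning from the stalk to sections requires that `F` have no torsion
(`InfeqStructure.genGermM_injective`). The annihilator of the torsion is a nonzero ideal stable
under derivations, and a smooth domain has no proper one (`eq_top_of_derivation_stable`): an Euler
field at a closed point acts on the `j`-th graded piece of the `m`-adic filtration as `j`, so a
stable ideal inside `m` lies in every power of `m`. -/

/-- In a finite-dimensional representation of the positive part of the Witt algebra, all basis
elements of large degree act as zero. -/
lemma witt_eq_zero {K M : Type*} [Field K] [CharZero K] [AddCommGroup M] [Module K M]
    [FiniteDimensional K M] (e : ℕ → Module.End K M)
    (h1 : ∀ m, 1 ≤ m → e 1 * e m - e m * e 1 = ((m : K) - 1) • e m)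
    (h2 : ∀ m, 1 ≤ m → e 2 * e m - e m * e 2 = ((m : K) - 2) • e (m + 1))
    {j : ℕ} (hj : Module.finrank K M ^ 2 + 1 ≤ j) : e j = 0 := by
  by_contra hne
  have hM : Nontrivial M := by
    by_contra hM
    rw [not_nontrivial_iff_subsingleton] at hM
    exact hne (Subsingleton.elim _ _)
  have hr : 0 < Module.finrank K M := Module.finrank_pos
  have hfin : Module.finrank K (Module.End K M) = Module.finrank K M ^ 2 := by
    rw [Module.finrank_linearMap, sq]
  -- Nonvanishing descends from `j` through `[e 2, e i] = (i - 2) e (i + 1)`; the coefficient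
  -- degenerates at `i = 2`.
  have hdown : ∀ d i, i + d = j → 3 ≤ i → e i ≠ 0 := by
    intro d
    induction d with
    | zero => intro i hi _; simpa [← hi] using hne
    | succ d ih =>
      intro i hi h3 h0
      have h := h2 i (by omega)
      rw [h0, mul_zero, zero_mul, sub_zero] at h
      refine ih (i + 1) (by omega) (by omega) ?_
      refine (smul_eq_zero.mp h.symm).resolve_left ?_
      rw [sub_eq_zero]
      exact_mod_cast (by omega : i ≠ 2)
  let f : Module.End K (Module.End K M) := LinearMap.mulLeft K (e 1) - LinearMap.mulRight K (e 1)
  have hone : f.HasEigenvector (0 : K) 1 := by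
    rw [Module.End.hasEigenvector_iff, Module.End.mem_eigenspace_iff]
    refine ⟨?_, one_ne_zero⟩
    simp [f]
  have heig : ∀ i, 1 ≤ i → e i ≠ 0 → f.HasEigenvector ((i : K) - 1) (e i) := by
    intro i hi h
    rw [Module.End.hasEigenvector_iff, Module.End.mem_eigenspace_iff]
    exact ⟨h1 i hi, h⟩
  -- The identity adds one eigenvector, of eigenvalue 0. Since `e 1` has the same eigenvalue,
  -- indices start at 2.
  have hcard : ∀ s : Finset ℕ, (∀ i ∈ s, 2 ≤ i ∧ e i ≠ 0) →
      s.card + 1 ≤ Module.finrank K M ^ 2 := by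
    intro s hs
    have hli := Module.End.eigenvectors_linearIndependent' f
      (fun o : Option s ↦ o.elim (0 : K) fun i ↦ (i : K) - 1)
      (by
        rintro (_ | ⟨a, ha⟩) (_ | ⟨b, hb⟩) h
        · rfl
        · have : (b : K) = 1 := by simpa [sub_eq_zero] using h.symm
          have := (hs b hb).1
          norm_cast at *; omega
        · have : (a : K) = 1 := by simpa [sub_eq_zero] using h
          have := (hs a ha).1
          norm_cast at *; omega
        · have : (a : K) = b := by simpa using h
          norm_cast at this
          simp [this])
      (fun o ↦ o.elim 1 fun i ↦ e i)
      (by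
        rintro (_ | ⟨a, ha⟩)
        · exact hone
        · exact heig a (by have := (hs a ha).1; omega) (hs a ha).2)
    have := hli.fintype_card_le_finrank
    rw [hfin] at this
    simpa using this
  -- Bootstrapping: the independence of `1` and `e j` gives `r² ≥ 2`, so `r² ≥ 4` and `j ≥ 5`. This
  -- leaves room to get `e 2 ≠ 0` from `[e 2, e 3] = e 4`.
  have h2r : 2 ≤ Module.finrank K M ^ 2 := by
    have := hcard {j} (by
      intro i hi
      rw [Finset.mem_singleton] at hi
      subst hi
      exact ⟨by have := Nat.pow_pos (n := 2) hr; omega, hne⟩)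
    simpa using this
  have h4r : 4 ≤ Module.finrank K M ^ 2 := by
    have : 2 ≤ Module.finrank K M := by
      by_contra h
      have : Module.finrank K M = 1 := by omega
      simp [this] at h2r
    nlinarith
  -- The `j - 1` operators `e 2, …, e j` and the identity give `j ≤ r²`, a contradiction.
  have := hcard (Finset.Icc 2 j) (by
    intro i hi
    rw [Finset.mem_Icc] at hi
    refine ⟨hi.1, ?_⟩
    rcases Nat.lt_or_ge i 3 with h | h
    · have hi2 : i = 2 := by omega
      subst hi2
      intro h0
      have h := h2 3 (by omega)
      rw [h0, mul_zero, zero_mul, sub_zero] at h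
      refine hdown (j - 4) 4 (by omega) (by omega) ?_
      refine (smul_eq_zero.mp h.symm).resolve_left ?_
      norm_num
    · exact hdown (j - i) i (by omega) h)
  rw [Nat.card_Icc] at this
  omega

variable {K B M : Type*} [Field K] [CharZero K] [CommRing B] [Algebra K B]
  [AddCommGroup M] [Module K M]

/-- If an ideal of vector fields `b δ` vanishing at a point acts linearly on a finite-dimensional
space, then it acts through a jet of order at most the square of the dimension. -/
theorem map_pow_mul_eq_zero [FiniteDimensional K M] (δ : Derivation K B B) (Δ : Ideal B)
    (Ψ : B →ₗ[K] Module.End ℤ M)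
    (hlin : ∀ b ∈ Δ, ∀ (c : K) (m : M), Ψ b (c • m) = c • Ψ b m)
    (hlie : ∀ b ∈ Δ, ∀ c ∈ Δ, Ψ (b * δ c - c * δ b) = Ψ b * Ψ c - Ψ c * Ψ b)
    {t : B} (ht : t ∈ Δ) (hδt : δ t = 1)
    {n : ℕ} (hn : Module.finrank K M ^ 2 + 1 ≤ n) (b : B) : Ψ (t ^ n * b) = 0 := by
  have hpow : ∀ m, 1 ≤ m → t ^ m ∈ Δ := fun m hm ↦ Ideal.pow_mem_of_mem _ ht _ hm
  have hδpow : ∀ m : ℕ, δ (t ^ m) = (m : B) * t ^ (m - 1) := fun m ↦ by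
    rw [Derivation.leibniz_pow, hδt]; simp
  have hzero : ∀ j, Module.finrank K M ^ 2 + 1 ≤ j → Ψ (t ^ j) = 0 := by
    intro j hj
    -- The value at 0 is a dummy: `t ^ 0 = 1` need not lie in `Δ`, so its operator need not be
    -- `K`-linear.
    let e : ℕ → Module.End K M := fun m ↦ if h : 1 ≤ m then
      { toFun := Ψ (t ^ m), map_add' := map_add _, map_smul' := hlin _ (hpow m h) } else 0
    have he : ∀ m, 1 ≤ m → ∀ v, e m v = Ψ (t ^ m) v := fun m hm v ↦ by simp [e, hm]
    have hcomm : ∀ a m, 1 ≤ a → 1 ≤ m → e a * e m - e m * e a = ((m : K) - a) • e (a + m - 1) := by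
      intro a m ha hm
      ext v
      have h := congrArg (fun φ ↦ φ v) (hlie _ (hpow a ha) _ (hpow m hm))
      have hb : t ^ a * δ (t ^ m) - t ^ m * δ (t ^ a) = ((m : K) - a) • t ^ (a + m - 1) := by
        rw [hδpow, hδpow, sub_smul, Algebra.smul_def, Algebra.smul_def]
        obtain ⟨a, rfl⟩ := Nat.exists_eq_add_of_le' ha
        obtain ⟨m, rfl⟩ := Nat.exists_eq_add_of_le' hm
        rw [show a + 1 + (m + 1) - 1 = a + m + 1 by omega]
        simp only [Nat.add_sub_cancel, map_natCast]
        ring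
      rw [hb, map_smul] at h
      simp only [LinearMap.smul_apply, LinearMap.sub_apply, Module.End.mul_apply] at h
      rw [LinearMap.sub_apply, Module.End.mul_apply, Module.End.mul_apply,
        LinearMap.smul_apply, he a ha, he m hm, he m hm, he a ha, he _ (by omega)]
      exact h.symm
    have h0 := witt_eq_zero e
      (fun m hm ↦ by simpa [add_comm 1 m] using hcomm 1 m le_rfl hm)
      (fun m hm ↦ by
        have := hcomm 2 m (by omega) hm
        rwa [show 2 + m - 1 = m + 1 by omega] at this) hj
    ext v
    rw [← he j (by omega), h0]; rfl
  have hker : ∀ x ∈ Δ, Ψ x = 0 → ∀ y ∈ Δ, Ψ (x * δ y - y * δ x) = 0 := by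
    intro x hx h0 y hy
    rw [hlie x hx y hy, h0, zero_mul, mul_zero, sub_zero]
  -- Adding the relations for the pairs `(x, y d)` and `(y, x d)` cancels all terms except `2 x y δ
  -- d`.
  have htwo : ∀ x ∈ Δ, Ψ x = 0 → ∀ y ∈ Δ, Ψ y = 0 → ∀ d, Ψ (x * y * δ d) = 0 := by
    intro x hx hx0 y hy hy0 d
    have h1 := hker x hx hx0 (y * d) (Δ.mul_mem_right _ hy)
    have h2 := hker y hy hy0 (x * d) (Δ.mul_mem_right _ hx)
    have h3 : (x * δ (y * d) - y * d * δ x) + (y * δ (x * d) - x * d * δ y) =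
        (2 : K) • (x * y * δ d) := by
      rw [two_smul]
      simp only [Derivation.leibniz, smul_eq_mul]
      ring
    have h4 := congrArg Ψ h3
    rw [map_add, h1, h2, map_smul, add_zero] at h4
    exact (smul_eq_zero.mp h4.symm).resolve_left two_ne_zero
  have hthree : ∀ x ∈ Δ, Ψ x = 0 → ∀ f, Ψ (x * x * x * f) = 0 := by
    intro x hx hx0 f
    have h : ∀ d d', Ψ (x * x * x * (δ d * δ d')) = 0 := by
      intro d d'
      have := htwo (x * x * δ d) (Δ.mul_mem_right _ (Δ.mul_mem_right _ hx))
        (htwo x hx hx0 x hx hx0 d) x hx hx0 d'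
      rw [← this]; congr 1; ring
    -- Every `f` is a combination of products of two derivatives: `f = δ (t f) δ t - δ (t² / 2) δ
    -- f`.
    have hf : x * x * x * f = x * x * x * (δ (t * f) * δ t) -
        x * x * x * (δ ((2⁻¹ : K) • (t * t)) * δ f) := by
      have : δ ((2⁻¹ : K) • (t * t)) = t := by
        rw [Derivation.map_smul, Derivation.leibniz, hδt, smul_eq_mul, mul_one, ← two_smul K,
          smul_smul,
          inv_mul_cancel₀ two_ne_zero, one_smul]
      rw [this, Derivation.leibniz, hδt]
      simp only [smul_eq_mul]
      ring
    rw [hf, map_sub, h, h, sub_zero]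
  -- The exponent `3 n` comes from `hthree` applied to `x = t ^ n`; descending induction then lowers
  -- it to `n`.
  set N := 3 * n with hN
  have hdesc : ∀ d j, j + d = N → n ≤ j → ∀ b, Ψ (t ^ j * b) = 0 := by
    intro d
    induction d with
    | zero =>
      intro j hj _ b
      have := hthree (t ^ n) (hpow n (by omega)) (hzero n hn) b
      rw [← this, ← pow_add, ← pow_add]
      congr 3
      omega
    | succ d ih =>
      intro j hj hnj b
      -- The coefficient `1 - j` used below vanishes at `j = 1`, but `n ≤ j ≤ 1` forces `M = 0`.
      rcases Nat.lt_or_ge j 2 with h | hj2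
      · have hr : Module.finrank K M = 0 := by
          by_contra h0
          have := Nat.pow_pos (n := 2) (Nat.pos_of_ne_zero h0)
          omega
        have := Module.finrank_zero_iff.mp hr
        exact LinearMap.ext fun v ↦ Subsingleton.elim _ _
      have h1 := hker (t ^ j) (hpow j (by omega)) (hzero j (by omega)) (t * b)
        (Δ.mul_mem_right _ ht)
      have h2 : t ^ j * δ (t * b) - t * b * δ (t ^ j) =
          t ^ (j + 1) * δ b + (1 - (j : K)) • (t ^ j * b) := by
        rw [hδpow, Derivation.leibniz, hδt, Algebra.smul_def (1 - (j : K))]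
        obtain ⟨i, rfl⟩ := Nat.exists_eq_add_of_le' (by omega : 1 ≤ j)
        simp only [smul_eq_mul, Nat.add_sub_cancel, map_sub, map_one, map_natCast]
        ring
      rw [h2, map_add, ih (j + 1) (by omega) (by omega), zero_add, map_smul] at h1
      refine (smul_eq_zero.mp h1).resolve_left ?_
      rw [sub_eq_zero]
      exact_mod_cast (by omega : 1 ≠ j)
  exact hdesc (N - n) n (by omega) le_rfl b

end WittIdeals

/-! ### Polynomials with vector coefficients -/

section Polynomial

/-- Linear functionals reduce this to a scalar polynomial with infinitely many roots. -/
lemma eq_zero_of_natCast_pow_smul {K V : Type*} [Field K] [CharZero K] [AddCommGroup V] [Module K V]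
    {N : ℕ} (v : ℕ → V) {S : Set ℕ} (hS : S.Infinite)
    (h : ∀ c ∈ S, ∑ i ∈ Finset.range N, (c : K) ^ i • v i = 0) {i : ℕ} (hi : i < N) : v i = 0 := by
  rw [← Module.forall_dual_apply_eq_zero_iff K]
  intro φ
  let p : Polynomial K := ∑ i ∈ Finset.range N, Polynomial.monomial i (φ (v i))
  have hp : p = 0 := by
    refine Polynomial.eq_zero_of_infinite_isRoot p
      ((hS.image (f := fun c : ℕ ↦ (c : K)) Nat.cast_injective.injOn).mono ?_)
    rintro _ ⟨c, hc, rfl⟩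
    have := congrArg φ (h c hc)
    simpa [p, Polynomial.eval_finsetSum, mul_comm] using this
  have := congrArg (fun q ↦ q.coeff i) hp
  simpa [p, Polynomial.finsetSum_coeff, Polynomial.coeff_monomial, hi] using this

end Polynomial

/-! ### Operators indexed by functions on the product, and polarization -/

section Diagonal

open TensorProduct

variable {A K M : Type*} [CommRing A] [Field K] [AddCommGroup M] [Module K M]

/-- The `K`-linear extension to `K ⊗ A` of a family of additive operators indexed by `A`. -/
def extendOps (ρ : A →+ Module.End ℤ M) : K ⊗[ℤ] A →ₗ[K] Module.End ℤ M :=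
  ρ.toIntLinearMap.liftBaseChange K

@[simp] lemma extendOps_tmul (ρ : A →+ Module.End ℤ M) (c : K) (a : A) :
    extendOps ρ (c ⊗ₜ a) = c • ρ a := rfl

/-- The `K`-linear extension of a derivation to `K ⊗ A`. -/
def derivBaseChange (δ : Derivation ℤ A A) : Derivation K (K ⊗[ℤ] A) (K ⊗[ℤ] A) :=
  Derivation.mk' ((δ : A →ₗ[ℤ] A).baseChange K) fun b c ↦ by
    induction b with
    | zero => simp
    | add b b' hb hb' => simp only [add_mul, map_add, hb, hb', add_smul, smul_add]; abel
    | tmul x a =>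
      induction c with
      | zero => simp
      | add c c' hc hc' => simp only [mul_add, map_add, hc, hc', add_smul, smul_add]; abel
      | tmul y a' =>
        simp [tmul_add, mul_comm y x]

@[simp] lemma derivBaseChange_tmul (δ : Derivation ℤ A A) (c : K) (a : A) :
    derivBaseChange δ (c ⊗ₜ[ℤ] a) = c ⊗ₜ δ a := rfl

variable [Algebra A K]

variable (A K) in
/-- The multiplication `K ⊗ A → K`. -/
def evalDiag : K ⊗[ℤ] A →ₐ[K] K :=
  Algebra.TensorProduct.lift (AlgHom.id K K) (algebraMap A K).toIntAlgHom fun _ _ ↦ .all _ _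

@[simp] lemma evalDiag_tmul (c : K) (a : A) :
    evalDiag A K (c ⊗ₜ a) = c * algebraMap A K a := by
  simp [evalDiag]

variable (K) in
/-- The difference `1 ⊗ x - x ⊗ 1` of the two pullbacks of a function. -/
def diag (x : A) : K ⊗[ℤ] A := 1 ⊗ₜ x - algebraMap A K x ⊗ₜ 1

lemma diag_add (x y : A) : diag K (x + y) = diag K x + diag K y := by
  simp only [diag, tmul_add, map_add, add_tmul]; abel

lemma diag_natCast_mul (c : ℕ) (x : A) : diag K (c * x) = (c : K) • diag K x := by
  rw [← nsmul_eq_mul, Nat.cast_smul_eq_nsmul, diag, diag, map_nsmul, tmul_smul, smul_sub,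
    smul_tmul' c (algebraMap A K x)]

lemma evalDiag_diag (x : A) : evalDiag A K (diag K x) = 0 := by
  simp [diag]

/-- A Lie algebra of operators with symbols `a δ` on a finite-dimensional vector space depends on
`a` through a differential operator of order at most the square of the dimension. -/
theorem extendOps_diag_pow_mul [CharZero K] [FiniteDimensional K M] [IsFractionRing A K]
    (δ : Derivation ℤ A A) (ρ : A →+ Module.End ℤ M)
    (hleib : ∀ a b m, ρ a (algebraMap A K b • m) =
      algebraMap A K (a * δ b) • m + algebraMap A K b • ρ a m)
    (hlie : ∀ a b, ρ (a * δ b - b * δ a) = ρ a * ρ b - ρ b * ρ a)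
    {x : A} (hx : δ x = 1) (b : K ⊗[ℤ] A) :
    extendOps ρ (diag K x ^ (Module.finrank K M ^ 2 + 1) * b) = 0 := by
  -- The symbol of the operator of `b` is `evalDiag b` times `δ`, so it vanishes on the kernel of
  -- `evalDiag`.
  have hleib' : ∀ (b : K ⊗[ℤ] A) (a : A) (m : M), extendOps ρ b (algebraMap A K a • m) =
      (evalDiag A K b * algebraMap A K (δ a)) • m + algebraMap A K a • extendOps ρ b m := by
    intro b a m
    induction b with
    | zero => simp
    | add b c hb hc =>
      simp only [map_add, LinearMap.add_apply, hb, hc, add_mul, add_smul, smul_add]; abel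
    | tmul c y =>
      simp only [extendOps_tmul, LinearMap.smul_apply, hleib, evalDiag_tmul, smul_add, map_mul,
        smul_smul, mul_assoc, mul_comm c (algebraMap A K a)]
  -- An operator without symbol commutes with `A`; writing `c = a / s` and cancelling `s` extends
  -- this to `K`.
  have hlin : ∀ b ∈ RingHom.ker (evalDiag A K), ∀ (c : K) (m : M),
      extendOps ρ b (c • m) = c • extendOps ρ b m := by
    intro b hb c m
    rw [RingHom.mem_ker] at hb
    obtain ⟨a, s, hs, rfl⟩ := IsFractionRing.div_surjective (A := A) c
    have := (algebraMap A K).domain_nontrivial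
    have hs0 : algebraMap A K s ≠ 0 := IsFractionRing.to_map_ne_zero_of_mem_nonZeroDivisors hs
    have h1 := hleib' b s ((algebraMap A K a / algebraMap A K s) • m)
    rw [smul_smul, mul_div_cancel₀ _ hs0, hleib' b a m, hb] at h1
    simp only [zero_mul, zero_smul, zero_add] at h1
    rw [div_eq_inv_mul (algebraMap A K a), ← smul_smul _ _ (extendOps ρ b m), h1, smul_smul,
      inv_mul_cancel₀ hs0, one_smul, div_eq_inv_mul]
  -- `P b c` pulls the scalars of `c` out in front of the operator of `b`. It is the true composite
  -- only when that operator is `K`-linear, but the bracket formula `hPlie` in terms of `P` holds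
  -- for all `b` and `c`.
  let P : K ⊗[ℤ] A → K ⊗[ℤ] A →ₗ[K] Module.End ℤ M := fun b ↦
    LinearMap.liftBaseChange K (LinearMap.mulLeft ℤ (extendOps ρ b) ∘ₗ ρ.toIntLinearMap)
  have hP : ∀ (b : K ⊗[ℤ] A) (c : K) (a : A), P b (c ⊗ₜ a) = c • (extendOps ρ b * ρ a) :=
    fun _ _ _ ↦ rfl
  have hPadd : ∀ b b' c : K ⊗[ℤ] A, P (b + b') c = P b c + P b' c := by
    intro b b' c
    induction c with
    | zero => simp
    | add c c' hc hc' => simp only [map_add, hc, hc']; abel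
    | tmul c a => simp only [hP, map_add, add_mul, smul_add]
  have hPmul : ∀ b ∈ RingHom.ker (evalDiag A K), ∀ c, extendOps ρ b * extendOps ρ c = P b c := by
    intro b hb c
    induction c with
    | zero => simp
    | add c c' hc hc' => simp only [map_add, mul_add, hc, hc']
    | tmul c a =>
      ext m
      simp only [hP, extendOps_tmul, Module.End.mul_apply, LinearMap.smul_apply, hlin b hb]
  have hPlie : ∀ b c : K ⊗[ℤ] A,
      extendOps ρ (b * derivBaseChange δ c - c * derivBaseChange δ b) = P b c - P c b := by
    intro b c
    induction b with
    | zero =>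
      have := hPadd 0 0 c
      rw [add_zero, left_eq_add] at this
      simp [this]
    | add b b' hb hb' =>
      have h : (b + b') * derivBaseChange δ c - c * derivBaseChange δ (b + b') =
          (b * derivBaseChange δ c - c * derivBaseChange δ b) +
            (b' * derivBaseChange δ c - c * derivBaseChange δ b') := by
        rw [map_add]; ring
      rw [h, map_add, hb, hb', hPadd, map_add]; abel
    | tmul x a =>
      induction c with
      | zero =>
        have := hPadd 0 0 (x ⊗ₜ a)
        rw [add_zero, left_eq_add] at this
        simp [this]
      | add c c' hc hc' =>
        have h : x ⊗ₜ a * derivBaseChange δ (c + c') - (c + c') * derivBaseChange δ (x ⊗ₜ a) =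
            (x ⊗ₜ a * derivBaseChange δ c - c * derivBaseChange δ (x ⊗ₜ a)) +
              (x ⊗ₜ a * derivBaseChange δ c' - c' * derivBaseChange δ (x ⊗ₜ a)) := by
          rw [map_add]; ring
        rw [h, map_add, hc, hc', hPadd, map_add]; abel
      | tmul y a' =>
        have h : (x ⊗ₜ[ℤ] a : K ⊗[ℤ] A) * derivBaseChange δ (y ⊗ₜ a') -
            y ⊗ₜ a' * derivBaseChange δ (x ⊗ₜ a) = (x * y) ⊗ₜ (a * δ a' - a' * δ a) := by
          simp only [derivBaseChange_tmul, Algebra.TensorProduct.tmul_mul_tmul, tmul_sub, mul_comm]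
        rw [h, extendOps_tmul, hlie, hP, hP, extendOps_tmul, extendOps_tmul, smul_mul_assoc,
          smul_mul_assoc, smul_smul, smul_smul, mul_comm y x, smul_sub]
  refine map_pow_mul_eq_zero (derivBaseChange δ) (RingHom.ker (evalDiag A K)) (extendOps ρ) hlin
    ?_ (t := diag K x) ?_ ?_ le_rfl b
  · intro b hb c hc
    rw [hPlie, hPmul b hb, hPmul c hc]
  · exact evalDiag_diag x
  · rw [diag, map_sub, derivBaseChange_tmul, derivBaseChange_tmul, hx, δ.map_one_eq_zero, tmul_zero,
      sub_zero]
    rfl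

/-- If an operator vanishes on the `N`-th powers of all differences `1 ⊗ f - f ⊗ 1` with `f` outside
a thin set, then it vanishes on all products of `N` such differences. -/
lemma map_diag_pow_eq_zero [CharZero K] {V : Type*} [AddCommGroup V] [Module K V]
    (Φ : K ⊗[ℤ] A →ₗ[K] V) (N : ℕ) (f y : A) {S : Set ℕ} (hS : S.Infinite)
    (h : ∀ c ∈ S, Φ (diag K (f + (c : A) * y) ^ N) = 0) {i : ℕ} (hi : i ≤ N) :
    Φ (diag K y ^ i * diag K f ^ (N - i)) = 0 := by
  have h' : ∀ c ∈ S, ∑ i ∈ Finset.range (N + 1), (c : K) ^ i •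
      Φ ((N.choose i : K) • (diag K y ^ i * diag K f ^ (N - i))) = 0 := by
    intro c hc
    rw [← h c hc, diag_add, diag_natCast_mul, add_comm (diag K f), add_pow, map_sum]
    refine Finset.sum_congr rfl fun i _ ↦ ?_
    rw [← map_smul Φ, smul_pow]
    congr 1
    rw [smul_mul_assoc, smul_mul_assoc, Nat.cast_smul_eq_nsmul, nsmul_eq_mul,
      mul_comm _ ((N.choose i : ℕ) : K ⊗[ℤ] A)]
  have := eq_zero_of_natCast_pow_smul _ hS h' (i := i) (by omega)
  rw [map_smul] at this
  exact (smul_eq_zero.mp this).resolve_left (Nat.cast_ne_zero.mpr (Nat.choose_pos hi).ne')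

/-- Polarization, one factor at a time: the coefficient of `c` in the power of `diag K (f + c y)`
exchanges one factor `diag K f` for `diag K y`. -/
lemma map_diag_prod_eq_zero [CharZero K] {V : Type*} [AddCommGroup V] [Module K V]
    (Φ : K ⊗[ℤ] A →ₗ[K] V) (N : ℕ) (h : ∀ f : A, Φ (diag K f ^ N) = 0) (l : List A)
    (hl : l.length = N) : Φ (l.map (diag K)).prod = 0 := by
  have key : ∀ (l : List A) (m : ℕ), l.length + m = N → ∀ f : A,
      Φ ((l.map (diag K)).prod * diag K f ^ m) = 0 := by
    intro l
    induction l with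
    | nil =>
      rintro m hm f
      simp only [List.length_nil, zero_add] at hm
      simpa [hm] using h f
    | cons y l ih =>
      intro m hm f
      have := map_diag_pow_eq_zero (Φ ∘ₗ LinearMap.mulLeft K (l.map (diag K)).prod) (m + 1) f y
        Set.infinite_univ (fun c _ ↦ ih (m + 1) (by simp at hm; omega) _) (i := 1) (by omega)
      rw [← this]
      simp only [List.map_cons, List.prod_cons, LinearMap.comp_apply, LinearMap.mulLeft_apply,
        Nat.add_sub_cancel, pow_one]
      congr 1
      ring
  simpa using key l 0 (by omega) 0

end Diagonal

/-! ### Differential simplicity of smooth algebras -/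

section Simplicity

variable {k A : Type*} [Field k] [CommRing A] [Algebra k A]

/-- The differentials of algebra generators `s i` span `Ω[A⁄k]`. By projectivity the resulting
surjection from a free module splits, and the coordinates of the splitting composed with `d` are the
`η i`. -/
lemma exists_dual_derivations [Algebra.FiniteType k A] [Module.Projective A Ω[A⁄k]] :
    ∃ (n : ℕ) (s : Fin n → A) (η : Fin n → Derivation k A A),
      ∀ a, KaehlerDifferential.D k A a = ∑ i, η i a • KaehlerDifferential.D k A (s i) := by
  obtain ⟨S, hS⟩ := Algebra.FiniteType.out (R := k) (A := A)
  let e := S.equivFin.symm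
  let s : Fin S.card → A := fun i ↦ e i
  have hspan : Submodule.span A (Set.range fun i ↦ KaehlerDifferential.D k A (s i)) = ⊤ := by
    rw [← top_le_iff, ← KaehlerDifferential.span_range_derivation, Submodule.span_le]
    rintro _ ⟨a, rfl⟩
    have ha : a ∈ Algebra.adjoin k (S : Set A) := hS ▸ Algebra.mem_top
    induction ha using Algebra.adjoin_induction with
    | mem x hx =>
      exact Submodule.subset_span ⟨e.symm ⟨x, hx⟩, by simp [s]⟩
    | algebraMap r => simp
    | add x y _ _ hx hy => rw [map_add]; exact add_mem hx hy
    | mul x y _ _ hx hy =>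
      rw [Derivation.leibniz]
      exact add_mem (Submodule.smul_mem _ _ hy) (Submodule.smul_mem _ _ hx)
  let π : (Fin S.card → A) →ₗ[A] Ω[A⁄k] :=
    Fintype.linearCombination A fun i ↦ KaehlerDifferential.D k A (s i)
  have hπ : Function.Surjective π := by
    rw [← LinearMap.range_eq_top, Fintype.range_linearCombination, hspan]
  obtain ⟨σ, hσ⟩ := Module.projective_lifting_property π LinearMap.id hπ
  refine ⟨S.card, s,
    fun i ↦ (LinearMap.proj i ∘ₗ σ).compDer (KaehlerDifferential.D k A), fun a ↦ ?_⟩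
  have := congrArg (fun φ ↦ φ (KaehlerDifferential.D k A a)) hσ
  simpa [π, Fintype.linearCombination_apply] using this.symm

variable [IsAlgClosed k] [CharZero k]

/-- A smooth algebra over an algebraically closed field of characteristic zero which is a domain has
no nontrivial ideals stable under all derivations. -/
theorem eq_top_of_derivation_stable [IsDomain A] [Algebra.FiniteType k A]
    [Module.Projective A Ω[A⁄k]] (I : Ideal A) (hI : I ≠ ⊥)
    (hD : ∀ (D : Derivation k A A), ∀ a ∈ I, D a ∈ I) : I = ⊤ := by
  by_contra hne
  obtain ⟨m, hm, hIm⟩ := I.exists_le_maximal hne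
  have : IsNoetherianRing A := Algebra.FiniteType.isNoetherianRing k A
  have : Module.Finite k (A ⧸ m) := by
    let := Ideal.Quotient.field m
    exact finite_of_finite_type_of_isJacobsonRing k (A ⧸ m)
  have hbij : Function.Bijective (algebraMap k (A ⧸ m)) :=
    IsAlgClosed.algebraMap_bijective_of_isIntegral
  let ev : A → k := fun a ↦ (RingEquiv.ofBijective _ hbij).symm (Ideal.Quotient.mk m a)
  have hev : ∀ a, a - algebraMap k A (ev a) ∈ m := by
    intro a
    rw [← Ideal.Quotient.eq_zero_iff_mem, map_sub, sub_eq_zero]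
    exact ((RingEquiv.ofBijective _ hbij).apply_symm_apply (Ideal.Quotient.mk m a)).symm
  have hmul : ∀ a b, ev (a * b) = ev a * ev b := by simp [ev]
  have hadd : ∀ a b, ev (a + b) = ev a + ev b := by simp [ev]
  have hk : ∀ c : k, ev (algebraMap k A c) = c := fun c ↦
    (RingEquiv.ofBijective _ hbij).symm_apply_apply c
  -- The derivation `a ↦ a - a(m)` into `m / m²`; applied to the identity of
  -- `exists_dual_derivations`, it computes `E` modulo `m²`.
  let δ : Derivation k A m.Cotangent := Derivation.mk'
    { toFun := fun a ↦ m.toCotangent ⟨_, hev a⟩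
      map_add' := fun a b ↦ by
        rw [← map_add]; congr 1; ext; simp [hadd]; ring
      map_smul' := fun c a ↦ by
        rw [RingHom.id_apply, ← algebraMap_smul A c (m.toCotangent _), ← map_smul]; congr 1; ext
        simp [Algebra.smul_def, hmul, hk]; ring }
    (fun a b ↦ by
      simp only [LinearMap.coe_mk, AddHom.coe_mk]
      rw [← map_smul, ← map_smul, ← map_add, Ideal.toCotangent_eq, sq]
      have : ((⟨_, hev (a * b)⟩ : m) : A) -
          ((a • (⟨_, hev b⟩ : m) + b • (⟨_, hev a⟩ : m) : m) : A) =
          -((a - algebraMap k A (ev a)) * (b - algebraMap k A (ev b))) := by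
        simp [hmul]; ring
      rw [this]
      exact neg_mem (Ideal.mul_mem_mul (hev a) (hev b)))
  obtain ⟨n, s, η, hη⟩ := exists_dual_derivations (k := k) (A := A)
  -- An Euler field at the closed point `m`: it is the identity on `m / m²`.
  let E : Derivation k A A := ∑ i, (s i - algebraMap k A (ev (s i))) • η i
  have hE : ∀ a, E a = ∑ i, (s i - algebraMap k A (ev (s i))) * η i a := by
    intro a
    have := congrFun (map_sum (Derivation.coeFnAddMonoidHom (R := k) (A := A) (M := A))
      (fun i ↦ (s i - algebraMap k A (ev (s i))) • η i) Finset.univ) a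
    rw [Finset.sum_apply] at this
    exact this
  have hE1 : ∀ a ∈ m, E a - a ∈ m ^ 2 := by
    intro a ha
    have h := congrArg δ.liftKaehlerDifferential (hη a)
    simp only [map_sum, map_smul, Derivation.liftKaehlerDifferential_comp_D] at h
    change m.toCotangent ⟨_, hev a⟩ = ∑ i, η i a • m.toCotangent ⟨_, hev (s i)⟩ at h
    simp only [← map_smul, ← map_sum] at h
    rw [eq_comm, Ideal.toCotangent_eq] at h
    have ha0 : ev a = 0 := by simp [ev, Ideal.Quotient.eq_zero_iff_mem.mpr ha]
    rw [hE]
    convert h using 2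
    · simp [mul_comm]
    · simp [ha0]
  have hEk : ∀ j : ℕ, ∀ a ∈ m ^ j, E a - (j : A) * a ∈ m ^ (j + 1) := by
    intro j
    induction j with
    | zero =>
      intro a _
      rw [hE]
      simpa using Ideal.sum_mem _ fun i _ ↦ m.mul_mem_right _ (hev (s i))
    | succ j ih =>
      intro a ha
      rw [pow_succ] at ha
      refine Submodule.mul_induction_on ha ?_ ?_
      · intro g hg h hh
        have : E (g * h) - ((j + 1 : ℕ) : A) * (g * h) =
            g * (E h - h) + (E g - (j : A) * g) * h := by
          rw [Derivation.leibniz]; simp; ring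
        rw [this]
        refine add_mem ?_ ?_
        · have := Ideal.mul_mem_mul hg (hE1 h hh)
          rwa [← pow_add] at this
        · have := Ideal.mul_mem_mul (ih g hg) hh
          rwa [← pow_succ] at this
      · intro x y hx hy
        have := add_mem hx hy
        convert this using 1
        rw [map_add]; ring
  -- If `I ≤ m ^ j` with `j ≥ 1`, then on `I` both `E a` and `E a - j a` lie in `m ^ (j + 1)`, and
  -- `j` is invertible.
  have hpow : ∀ j : ℕ, I ≤ m ^ (j + 1) := by
    intro j
    induction j with
    | zero => simpa using hIm
    | succ j ih =>
      intro a ha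
      have h1 : E a ∈ m ^ (j + 1 + 1) := by
        rw [hE, pow_succ']
        exact Ideal.sum_mem _ fun i _ ↦ Ideal.mul_mem_mul (hev (s i)) (ih (hD (η i) a ha))
      have h2 := sub_mem h1 (hEk (j + 1) a (ih ha))
      rw [sub_sub_cancel] at h2
      have h3 : IsUnit ((j + 1 : ℕ) : A) := by
        rw [← map_natCast (algebraMap k A)]
        exact (Ne.isUnit (Nat.cast_ne_zero.mpr (Nat.succ_ne_zero j))).map _
      exact (Ideal.unit_mul_mem_iff_mem _ h3).mp h2
  refine hI (le_bot_iff.mp ?_)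
  rw [← Ideal.iInf_pow_eq_bot_of_isDomain m hm.ne_top]
  refine le_iInf fun j ↦ (hpow j).trans (Ideal.pow_le_pow_right (Nat.le_succ j))

end Simplicity

/-! ### Extending derivations to the fraction field -/

section FractionDerivation

/-- A derivation is a ring homomorphism `a ↦ a + D a ε` to the dual numbers. It extends by the
universal property of localization, since nonzero first components are units there. -/
lemma exists_derivation_extending {A K : Type*} [CommRing A] [Field K] [Algebra A K]
    [IsFractionRing A K] (D : Derivation ℤ A A) :
    ∃ D' : Derivation ℤ K K, ∀ a, D' (algebraMap A K a) = algebraMap A K (D a) := by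
  let φ : A →+* TrivSqZeroExt K K :=
    { toFun := fun a ↦ (algebraMap A K a, algebraMap A K (D a))
      map_one' := TrivSqZeroExt.ext (map_one _) (by
        change algebraMap A K (D 1) = 0
        simp)
      map_zero' := TrivSqZeroExt.ext (map_zero _) (by
        change algebraMap A K (D 0) = 0
        simp)
      map_add' := fun a b ↦ TrivSqZeroExt.ext (map_add _ _ _) (by
        change algebraMap A K (D (a + b)) = algebraMap A K (D a) + algebraMap A K (D b)
        simp)
      map_mul' := fun a b ↦ TrivSqZeroExt.ext (map_mul _ _ _) (by
        change algebraMap A K (D (a * b)) = algebraMap A K a * algebraMap A K (D b) +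
          algebraMap A K (D a) * algebraMap A K b
        simp only [Derivation.leibniz, smul_eq_mul, map_add, map_mul]
        ring) }
  have hφ₁ : ∀ a, (φ a).fst = algebraMap A K a := fun _ ↦ rfl
  have hφ₂ : ∀ a, (φ a).snd = algebraMap A K (D a) := fun _ ↦ rfl
  have := (algebraMap A K).domain_nontrivial
  have hφ : ∀ y : nonZeroDivisors A, IsUnit (φ y) := by
    intro y
    rw [TrivSqZeroExt.isUnit_iff_isUnit_fst]
    rw [hφ₁]
    exact (IsFractionRing.to_map_ne_zero_of_mem_nonZeroDivisors y.2).isUnit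
  let ψ : K →+* TrivSqZeroExt K K := IsLocalization.lift hφ
  have hψ : ∀ a, ψ (algebraMap A K a) = φ a := IsLocalization.lift_eq hφ
  have hfst : ∀ x, (ψ x).fst = x := by
    have h : (TrivSqZeroExt.fstHom ℤ K K : TrivSqZeroExt K K →+* K).comp ψ = RingHom.id K := by
      refine IsLocalization.ringHom_ext (nonZeroDivisors A) ?_
      ext a
      exact (congrArg TrivSqZeroExt.fst (hψ a)).trans (hφ₁ a)
    exact fun x ↦ congrArg (fun f ↦ f x) h
  refine ⟨Derivation.mk' (AddMonoidHom.toIntLinearMap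
    { toFun := fun x ↦ (ψ x).snd, map_zero' := by simp, map_add' := fun x y ↦ by simp })
    fun x y ↦ ?_, fun a ↦ ?_⟩
  · change (ψ (x * y)).snd = x * (ψ y).snd + y * (ψ x).snd
    rw [map_mul, TrivSqZeroExt.snd_mul, hfst, hfst, op_smul_eq_smul, smul_eq_mul, smul_eq_mul]
  · change (ψ _).snd = _
    rw [hψ, hφ₂]

end FractionDerivation

/-! ### Germs of functions at the generic point -/

section Germs

variable {X : Scheme.{u}} [IsIntegral X]

/-- The germ of a function at the generic point. -/
def genGerm (V : X.Opens) (h : genericPoint X ∈ V) : Γ(X, V) →+* X.functionField :=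
  (X.presheaf.germ V _ h).hom

lemma genericPoint_mem {V : X.Opens} {x : X} (hx : x ∈ V) : genericPoint X ∈ V :=
  ((genericPoint_spec X).mem_open_set_iff V.isOpen).mpr ⟨x, trivial, hx⟩

lemma genGerm_res (k : Type u) [Field k] [X.Over (Spec (.of k))] {V W : X.Opens} (hW : W ≤ V)
    (h : genericPoint X ∈ W) (f : Γ(X, V)) :
    genGerm W h (resO (k := k) hW f) = genGerm V (hW h) f :=
  X.presheaf.germ_res_apply (homOfLE hW) _ h f

lemma genGerm_injective (V : X.Opens) (h : genericPoint X ∈ V) :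
    Function.Injective (genGerm V h) :=
  germ_injective_of_isIntegral X _ h

lemma ext_genGerm {V : X.Opens} {f g : Γ(X, V)} (hfg : ∀ h, genGerm V h f = genGerm V h g) :
    f = g := by
  by_cases hV : ∃ x, x ∈ V
  · obtain ⟨x, hx⟩ := hV
    exact genGerm_injective V (genericPoint_mem hx) (hfg _)
  · have : V = ⊥ := by
      ext x
      simpa using fun hx ↦ hV ⟨x, hx⟩
    subst this
    exact Subsingleton.elim _ _

lemma isFractionRing_genGerm {W : X.Opens} (hW : IsAffineOpen W) (h : genericPoint X ∈ W) :
    @IsFractionRing Γ(X, W) _ X.functionField _ (genGerm W h).toAlgebra := by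
  have : Nonempty W := ⟨⟨_, h⟩⟩
  exact functionField_isFractionRing_of_isAffineOpen X W hW

end Germs

/-! ### Derivations on an affine open as vector fields -/

section Extension

variable (k : Type u) [Field k] {X : Scheme.{u}} [X.Over (Spec (.of k))] [IsIntegral X]

lemma exists_derivative_basicOpen {W : X.Opens} (hW : IsAffineOpen W)
    (D : Derivation k Γ(X, W) Γ(X, W)) (D' : Derivation ℤ X.functionField X.functionField)
    (hD' : ∀ h a, D' (genGerm W h a) = genGerm W h (D a)) (a : Γ(X, W))
    (f : Γ(X, X.basicOpen a)) :
    ∃ g : Γ(X, X.basicOpen a), ∀ h, genGerm _ h g = D' (genGerm _ h f) := by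
  have := hW.isLocalization_basicOpen a
  obtain ⟨n, b, hb⟩ := IsLocalization.Away.surj a f
  have hle := X.basicOpen_le a
  let r := resO (k := k) hle
  have hr : ∀ x : Γ(X, W), algebraMap Γ(X, W) Γ(X, X.basicOpen a) x = r x := fun _ ↦ rfl
  rw [hr, hr, ← map_pow] at hb
  have hu : IsUnit (r (a ^ n)) := by
    rw [map_pow]
    exact (IsLocalization.Away.algebraMap_isUnit a).pow n
  obtain ⟨v, hv⟩ := hu.exists_right_inv
  -- The quotient rule for `f = b / a ^ n`, with `v` the inverse of `a ^ n`.
  refine ⟨(r (D b) - f * r (D (a ^ n))) * v, fun h ↦ ?_⟩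
  have h1 := congrArg (fun x ↦ D' (genGerm _ h x)) hb
  have h2 := congrArg (genGerm _ h) hv
  simp only [map_mul, Derivation.leibniz, smul_eq_mul, r, genGerm_res k hle h, hD', map_one,
    map_sub] at h1 h2 ⊢
  rw [← h1, mul_comm (genGerm (X.basicOpen a) h f), add_sub_cancel_left, mul_right_comm,
    h2, one_mul]

/-- `V` need not be affine: it is covered by basic opens of `W`, and the local derivatives glue
because their generic germs agree. -/
lemma exists_derivative {W : X.Opens} (hW : IsAffineOpen W)
    (D : Derivation k Γ(X, W) Γ(X, W)) (D' : Derivation ℤ X.functionField X.functionField)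
    (hD' : ∀ h a, D' (genGerm W h a) = genGerm W h (D a)) {V : X.Opens} (hV : V ≤ W)
    (f : Γ(X, V)) :
    ∃ g : Γ(X, V), ∀ h, genGerm V h g = D' (genGerm V h f) := by
  choose a haV ha using fun x : V ↦ hW.exists_basicOpen_le x (hV x.2)
  choose g hg using fun x : V ↦ exists_derivative_basicOpen k hW D D' hD' (a x)
    (resO (k := k) (haV x) f)
  obtain ⟨s, hs, -⟩ := TopCat.Sheaf.existsUnique_gluing' X.sheaf (fun x : V ↦ X.basicOpen (a x)) V
    (fun x ↦ homOfLE (haV x)) (fun x hx ↦ TopologicalSpace.Opens.mem_iSup.mpr ⟨⟨x, hx⟩, ha _⟩) g (by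
      intro x y
      refine ext_genGerm fun h ↦ ?_
      refine (genGerm_res k inf_le_left h (g x)).trans
        (Eq.trans ?_ (genGerm_res k inf_le_right h (g y)).symm)
      rw [hg, hg, genGerm_res, genGerm_res])
  refine ⟨s, fun h ↦ ?_⟩
  have := ha ⟨_, h⟩
  have h1 := hg ⟨_, h⟩ this
  rw [genGerm_res, ← hs ⟨_, h⟩] at h1
  rw [← h1]
  exact (genGerm_res k (haV ⟨_, h⟩) this s).symm

/-- Every derivation of the functions on an affine open set extends to a vector field. -/
theorem exists_tangent_deriv_eq {W : X.Opens} (hW : IsAffineOpen W)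
    (D : Derivation k Γ(X, W) Γ(X, W)) : ∃ E : Tangent k X W, E.deriv = D := by
  obtain ⟨D', hD'⟩ : ∃ D' : Derivation ℤ X.functionField X.functionField,
      ∀ h a, D' (genGerm W h a) = genGerm W h (D a) := by
    by_cases h : genericPoint X ∈ W
    · let := (genGerm W h).toAlgebra
      have := isFractionRing_genGerm hW h
      obtain ⟨D', hD'⟩ := exists_derivation_extending (K := X.functionField)
        (Derivation.mk' (D : Γ(X, W) →ₗ[k] Γ(X, W)).toAddMonoidHom.toIntLinearMap D.leibniz)
      exact ⟨D', fun _ ↦ hD'⟩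
    · exact ⟨0, fun h' ↦ absurd h' h⟩
  choose g hg using fun (V : X.Opens) (hV : V ≤ W) (f : Γ(X, V)) ↦
    exists_derivative k hW D D' hD' hV f
  refine ⟨⟨fun V hV ↦ Derivation.mk'
    { toFun := g V hV
      map_add' := fun a b ↦ ext_genGerm fun h ↦ by simp only [hg, map_add]
      map_smul' := fun c a ↦ ext_genGerm fun h ↦ by
        -- `D'` is only additive; it kills constants because they are restricted from `W`, where `D`
        -- is `k`-linear.
        have hc : algebraMap k Γ(X, V) c = resO (k := k) hV (algebraMap k Γ(X, W) c) :=
          ((resO hV).commutes c).symm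
        rw [RingHom.id_apply, Algebra.smul_def, Algebra.smul_def, hc, hg, map_mul (genGerm V h),
          map_mul (genGerm V h), Derivation.leibniz, genGerm_res, hD',
          Derivation.map_algebraMap, map_zero, hg, smul_zero,
          add_zero, smul_eq_mul] }
    (fun a b ↦ ext_genGerm fun h ↦ by
      simp only [LinearMap.coe_mk, AddHom.coe_mk, hg, map_mul, map_add, Derivation.leibniz,
        smul_eq_mul]), ?_⟩, ?_⟩
  · intro V U hV hU a
    refine ext_genGerm fun h ↦ ?_
    change genGerm U h (g U _ _) = genGerm U h (resO hU (g V _ _))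
    rw [genGerm_res, hg, hg, genGerm_res]
  · ext a
    refine ext_genGerm fun h ↦ ?_
    change genGerm W h (g W _ _) = _
    rw [hg, hD']

end Extension
-- Quasi-coherent sheaves of finite type on affine opens
section
variable {X : Scheme.{u}}

/-- Transport from the slice over a member of the cover to the spectrum of a smaller affine is a
composite of colimit-preserving functors, so it keeps generating sections. -/
lemma exists_generatingSections_restrict (F : X.Modules) (hft : SheafOfModules.IsFiniteType.{u} F)
    {V : X.Opens} {x : X} (hx : x ∈ V) :
    ∃ (W : X.Opens) (hW : IsAffineOpen W) (_ : x ∈ W) (_ : W ≤ V)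
      (G : SheafOfModules.GeneratingSections.{u} (F.restrict hW.fromSpec)), Finite G.I := by
  obtain ⟨σ, hσ⟩ := hft.exists_localGeneratorsData
  have cov := σ.coversTop
  rw [Opens.coversTop_iff] at cov
  obtain ⟨i, hi⟩ := TopologicalSpace.Opens.mem_iSup.mp (cov ▸ TopologicalSpace.Opens.mem_top x)
  obtain ⟨W, hW, hxW, hWiV⟩ := TopologicalSpace.Opens.isBasis_iff_nbhd.mp X.isBasis_affineOpens
    (show x ∈ σ.X i ⊓ V from ⟨hi, hx⟩)
  have hWi := hWiV.trans inf_le_left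
  have hW : IsAffineOpen W := hW
  have hfin : Finite (σ.generators i).I := (hσ.isFiniteType i).finite
  let Y : X.Opens := σ.X i
  let G₀ : SheafOfModules.GeneratingSections (SheafOfModules.over F Y) := σ.generators i
  refine ⟨W, hW, hxW, hWiV.trans inf_le_right, ?_⟩
  let v : Spec Γ(X, W) ⟶ (Y : Scheme) := hW.isoSpec.inv ≫ X.homOfLE hWi
  have hv : v ≫ Y.ι = hW.fromSpec := by simp [v, IsAffineOpen.isoSpec_inv_ι]
  have : Limits.PreservesColimitsOfSize.{u, u} (Scheme.Modules.restrictFunctor v) := inferInstance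
  let H : SheafOfModules.{u} (X.ringCatSheaf.over Y) ⥤
      SheafOfModules.{u} (Spec Γ(X, W)).ringCatSheaf :=
    (Scheme.Modules.overEquiv Y).functor ⋙ Scheme.Modules.restrictFunctor v
  let iso : SheafOfModules.overFunctor X.ringCatSheaf _ ⋙ H ≅
      Scheme.Modules.restrictFunctor hW.fromSpec :=
    (Functor.associator _ _ _).symm ≪≫
      Functor.isoWhiskerRight (Scheme.Modules.overFunctorEquiv _) _ ≪≫
      (Scheme.Modules.restrictFunctorComp _ _).symm ≪≫ Scheme.Modules.restrictFunctorCongr hv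
  have hH : Limits.PreservesColimitsOfSize.{u, u} H :=
    Limits.comp_preservesColimits (E := (Spec Γ(X, W)).Modules) (Scheme.Modules.overEquiv Y).functor
      (Scheme.Modules.restrictFunctor v)
  let G := G₀.map H (Scheme.Modules.restrictUnitIso _).symm
  let e : H.obj (SheafOfModules.over F Y) ⟶ F.restrict hW.fromSpec := (iso.app F).hom
  have he : @Epi (SheafOfModules (Spec Γ(X, W)).ringCatSheaf) _ _ _ e :=
    @IsIso.epi_of_iso (Scheme.Modules _) _ _ _ _ (iso.app F).isIso_hom
  exact ⟨@SheafOfModules.GeneratingSections.ofEpi _ _ _ _ _ _ _ _ G e he, hfin⟩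

/-- Between sheaves `M~`, the epimorphism from a finite free sheaf comes from a map of modules,
because tilde is full; that map is epi, because tilde is faithful. -/
lemma finite_sections_of_generatingSections {R : CommRingCat.{u}} (M : (Spec R).Modules)
    [M.IsQuasicoherent]
    (G : SheafOfModules.GeneratingSections.{u} M) [Finite G.I] :
    Module.Finite R ((modulesSpecToSheaf.obj M).presheaf.obj (op ⊤)) := by
  have h1 : IsIso M.fromTildeΓ := (isQuasicoherent_iff_isIso_fromTildeΓ M).mp ‹_›
  let e := @asIso _ _ _ _ M.fromTildeΓ h1
  let π : (SheafOfModules.free G.I : (Spec R).Modules) ⟶ M := G.π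
  have hπ : Epi π := G.epi
  let φ : (tilde.functor R).obj (ModuleCat.of R (G.I →₀ R)) ⟶
      (tilde.functor R).obj ((modulesSpecToSheaf.obj M).presheaf.obj (op ⊤)) :=
    (tildeFinsupp G.I).hom ≫ π ≫ e.inv
  have : Epi φ := by
    have h2 : Epi (π ≫ e.inv) := epi_comp' hπ (IsIso.epi_of_iso e.inv)
    exact epi_comp' (@IsIso.epi_of_iso _ _ _ _ _ (tildeFinsupp G.I).isIso_hom) h2
  have h : (tilde.functor R).map ((tilde.functor R).preimage φ) = φ := Functor.map_preimage _ _
  have : Epi ((tilde.functor R).preimage φ) := by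
    apply (tilde.functor R).epi_of_epi_map
    rw [h]; infer_instance
  exact Module.Finite.of_surjective ((tilde.functor R).preimage φ).hom
    ((ModuleCat.epi_iff_surjective _).mp this)

lemma ΓSpecIso_inv_appIso_inv {W : X.Opens} (hW : IsAffineOpen W)
    (U : (Spec Γ(X, W)).Opens) (hU : hW.fromSpec ''ᵁ U ≤ W) :
    (Scheme.ΓSpecIso Γ(X, W)).inv ≫ (Spec Γ(X, W)).presheaf.map U.leTop.op ≫
      (hW.fromSpec.appIso U).inv = X.presheaf.map (homOfLE hU).op := by
  rw [← Category.assoc, Iso.comp_inv_eq, Scheme.Hom.appIso_hom', Scheme.Hom.map_appLE,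
    Scheme.Hom.appLE, hW.fromSpec_app_self, Category.assoc, ← Functor.map_comp]
  rfl

lemma restrictAppIso_hom_smul {W : X.Opens} (hW : IsAffineOpen W) (F : X.Modules)
    (U : (Spec Γ(X, W)).Opens) (hU : hW.fromSpec ''ᵁ U ≤ W) (r : Γ(X, W))
    (m : Γ(F.restrict hW.fromSpec, U)) :
    (F.restrictAppIso hW.fromSpec U).hom (r • m) =
      X.presheaf.map (homOfLE hU).op r • (F.restrictAppIso hW.fromSpec U).hom m := by
  rw [Scheme.Modules.smul_Spec_def, ← ΓSpecIso_inv_appIso_inv hW U hU]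
  rfl

lemma image_fromSpec_top {W : X.Opens} (hW : IsAffineOpen W) : hW.fromSpec ''ᵁ ⊤ = W := by
  rw [Scheme.Hom.image_top_eq_opensRange, hW.opensRange_fromSpec]

/-- The basic open set of the spectrum, as an open set of the scheme. -/
def specBasicOpen {R : CommRingCat.{u}} (f : R) : (Spec R).Opens := PrimeSpectrum.basicOpen f

lemma image_fromSpec_specBasicOpen {W : X.Opens} (hW : IsAffineOpen W) (f : Γ(X, W)) :
    hW.fromSpec ''ᵁ specBasicOpen f = X.basicOpen f :=
  hW.fromSpec_image_basicOpen f

section Spec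

variable {R : CommRingCat.{u}} (M : (Spec R).Modules) [M.IsQuasicoherent] (f : R)

lemma isLocalizedModule_map_basicOpen :
    IsLocalizedModule (.powers f) ((modulesSpecToSheaf.obj M).obj.map
      (PrimeSpectrum.basicOpen f).leTop.op).hom :=
  (isIso_fromTildeΓ_iff_isLocalizing M).mp ((isQuasicoherent_iff_isIso_fromTildeΓ M).mp ‹_›) f

lemma spec_exists_pow_smul_eq_zero (m : Γ(M, ⊤))
    (hm : M.presheaf.map (specBasicOpen f).leTop.op m = 0) : ∃ n : ℕ, f ^ n • m = 0 := by
  have := isLocalizedModule_map_basicOpen M f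
  obtain ⟨⟨_, n, rfl⟩, hn⟩ := (IsLocalizedModule.eq_zero_iff (.powers f)
    ((modulesSpecToSheaf.obj M).obj.map (PrimeSpectrum.basicOpen f).leTop.op).hom).mp hm
  exact ⟨n, hn⟩

lemma spec_exists_map_eq_pow_smul (s : Γ(M, specBasicOpen f)) :
    ∃ (n : ℕ) (t : Γ(M, ⊤)), M.presheaf.map (specBasicOpen f).leTop.op t = f ^ n • s := by
  have := isLocalizedModule_map_basicOpen M f
  obtain ⟨⟨t, ⟨_, n, rfl⟩⟩, ht⟩ := this.surj s
  exact ⟨n, t, ht.symm⟩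

end Spec

lemma resM_resM (F : X.Modules) {V W Z : X.Opens} (h : W ≤ V) (h' : Z ≤ W) (m : Γ(F, V)) :
    resM F h' (resM F h m) = resM F (h'.trans h) m := by
  change (F.presheaf.map _ ≫ F.presheaf.map _) m = _
  rw [← Functor.map_comp]
  rfl

lemma resM_self (F : X.Modules) {V : X.Opens} (h : V ≤ V) (m : Γ(F, V)) : resM F h m = m := by
  change F.presheaf.map (𝟙 _) m = _
  rw [F.presheaf.map_id]
  rfl

/-- Sections over a basic open are a localization; the statement is proved on the spectrum and
carried to `W` along `fromSpec`. -/
lemma exists_pow_smul_eq_zero (k : Type u) [Field k] [X.Over (Spec (.of k))]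
    {W : X.Opens} (hW : IsAffineOpen W) (F : X.Modules)
    [F.IsQuasicoherent] (f : Γ(X, W)) (m : Γ(F, W)) (hm : resM F (X.basicOpen_le f) m = 0) :
    ∃ n : ℕ, f ^ n • m = 0 := by
  have := Scheme.Modules.isQuasicoherent_restrictFunctor hW.fromSpec F
  obtain ⟨n, hn⟩ := spec_exists_pow_smul_eq_zero (F.restrict hW.fromSpec) f
    ((F.restrictAppIso hW.fromSpec ⊤).inv (resM F (image_fromSpec_top hW).le m)) (by
      have hle := (image_fromSpec_specBasicOpen hW f).le
      change resM F (Scheme.Hom.image_mono _ le_top) (resM F _ m) = 0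
      rw [resM_resM, ← resM_resM F (X.basicOpen_le f) hle, hm, map_zero])
  refine ⟨n, ?_⟩
  have h2 := congrArg (F.restrictAppIso hW.fromSpec ⊤).hom hn
  rw [restrictAppIso_hom_smul hW F ⊤ (image_fromSpec_top hW).le, map_zero] at h2
  change resO (k := k) (image_fromSpec_top hW).le (f ^ n) •
    resM F (image_fromSpec_top hW).le m = 0 at h2
  rw [← resM_smul k] at h2
  have h3 := congrArg (resM F (image_fromSpec_top hW).ge) h2
  rwa [resM_resM, resM_self, map_zero] at h3

lemma exists_resM_eq_pow_smul (k : Type u) [Field k] [X.Over (Spec (.of k))]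
    {W : X.Opens} (hW : IsAffineOpen W) (F : X.Modules)
    [F.IsQuasicoherent] (f : Γ(X, W)) (s : Γ(F, X.basicOpen f)) :
    ∃ (n : ℕ) (t : Γ(F, W)),
      resM F (X.basicOpen_le f) t = resO (k := k) (X.basicOpen_le f) f ^ n • s := by
  have := Scheme.Modules.isQuasicoherent_restrictFunctor hW.fromSpec F
  have heq := image_fromSpec_specBasicOpen hW f
  obtain ⟨n, t, ht⟩ := spec_exists_map_eq_pow_smul (F.restrict hW.fromSpec) f
    ((F.restrictAppIso hW.fromSpec _).inv (resM F heq.le s))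
  refine ⟨n, resM F (image_fromSpec_top hW).ge ((F.restrictAppIso hW.fromSpec ⊤).hom t), ?_⟩
  have h2 := congrArg (F.restrictAppIso hW.fromSpec _).hom ht
  rw [restrictAppIso_hom_smul hW F _ (heq.le.trans (X.basicOpen_le f))] at h2
  change resM F (Scheme.Hom.image_mono _ le_top) ((F.restrictAppIso hW.fromSpec ⊤).hom t) =
    resO (k := k) (heq.le.trans (X.basicOpen_le f)) (f ^ n) • resM F heq.le s at h2
  have h3 := congrArg (resM F heq.ge) h2
  rw [resM_smul k, resM_resM, resM_resM, resM_self, ← resO_trans] at h3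
  rw [resM_resM, ← map_pow]
  exact h3

lemma finite_sections (k : Type u) [Field k] [X.Over (Spec (.of k))]
    {W : X.Opens} (hW : IsAffineOpen W) (F : X.Modules) [F.IsQuasicoherent]
    (G : SheafOfModules.GeneratingSections.{u} (F.restrict hW.fromSpec)) [Finite G.I] :
    Module.Finite Γ(X, W) Γ(F, W) := by
  have := Scheme.Modules.isQuasicoherent_restrictFunctor hW.fromSpec F
  have hfin := finite_sections_of_generatingSections (F.restrict hW.fromSpec) G
  let φ : Γ(F.restrict hW.fromSpec, ⊤) →ₗ[Γ(X, W)] Γ(F, W) :=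
    { toFun := fun m ↦ resM F (image_fromSpec_top hW).ge ((F.restrictAppIso hW.fromSpec ⊤).hom m)
      map_add' := fun _ _ ↦ by simp
      map_smul' := fun r m ↦ by
        rw [restrictAppIso_hom_smul hW F ⊤ (image_fromSpec_top hW).le, RingHom.id_apply]
        change resM F _ (resO (k := k) (image_fromSpec_top hW).le r • _) = _
        rw [resM_smul k, ← resO_trans]
        have : resO (k := k) ((image_fromSpec_top hW).ge.trans (image_fromSpec_top hW).le) r = r :=
          congrArg (fun φ ↦ φ r) (X.presheaf.map_id (op W))
        rw [this] }
  refine @Module.Finite.of_surjective _ _ _ _ _ _ _ _ _ _ _ hfin φ fun m ↦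
    ⟨(F.restrictAppIso hW.fromSpec ⊤).inv (resM F (image_fromSpec_top hW).le m), ?_⟩
  change resM F _ (resM F _ m) = _
  rw [resM_resM, resM_self]

end

/-! ### Smoothness of rings of sections -/

section SmoothAlgebra

variable (k : Type u) [Field k] {X : Scheme.{u}} [X.Over (Spec (.of k))]

lemma smooth_sections [Smooth (X ↘ Spec (.of k))] {W : X.Opens} (hW : IsAffineOpen W) :
    Algebra.Smooth k Γ(X, W) := by
  have h := (X ↘ Spec (.of k)).smooth_appLE (isAffineOpen_top _) hW le_top
  have h' := (RingHom.Smooth.of_bijective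
    (ConcreteCategory.bijective_of_isIso (Scheme.ΓSpecIso (.of k)).inv)).comp h
  exact h'

end SmoothAlgebra

/-! ### The generic stalk and absence of torsion -/

section GenericStalk

variable {X : Scheme.{u}} [IsIntegral X] (F : X.Modules)

/-- The stalk of a sheaf of modules at the generic point. -/
def GenStalk : Type u := F.presheaf.stalk (genericPoint X)

instance : AddCommGroup (GenStalk F) :=
  inferInstanceAs (AddCommGroup (F.presheaf.stalk (genericPoint X)))

instance : Module X.functionField (GenStalk F) :=
  inferInstanceAs (Module (X.presheaf.stalk (genericPoint X))
    (F.presheaf.stalk (genericPoint X)))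

/-- The germ of a section at the generic point. -/
def genGermM (V : X.Opens) (h : genericPoint X ∈ V) : Γ(F, V) →+ GenStalk F :=
  (F.presheaf.germ V _ h).hom

variable {F}

lemma genGermM_res {V W : X.Opens} (hW : W ≤ V) (h : genericPoint X ∈ W) (m : Γ(F, V)) :
    genGermM F W h (resM F hW m) = genGermM F V (hW h) m :=
  F.presheaf.germ_res_apply (homOfLE hW) _ h m

lemma genGermM_smul {V : X.Opens} (h : genericPoint X ∈ V) (a : Γ(X, V)) (m : Γ(F, V)) :
    genGermM F V h (a • m) = genGerm V h a • genGermM F V h m :=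
  PresheafOfModules.germ_smul (R := X.presheaf) F.val _ V h a m

lemma exists_genGermM_eq (ξ : GenStalk F) {V : X.Opens} (hV : genericPoint X ∈ V) :
    ∃ (W : X.Opens) (_ : W ≤ V) (h : genericPoint X ∈ W) (m : Γ(F, W)), genGermM F W h m = ξ :=
  let ⟨W, hW, h, m, hm⟩ := F.presheaf.exists_le_germ_eq ξ hV
  ⟨W, hW, h, m, hm⟩

lemma genGermM_eq_iff {V W : X.Opens} {hV : genericPoint X ∈ V} {hW : genericPoint X ∈ W}
    {m : Γ(F, V)} {m' : Γ(F, W)} : genGermM F V hV m = genGermM F W hW m' ↔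
    ∃ (Z : X.Opens) (_ : genericPoint X ∈ Z) (h₁ : Z ≤ V) (h₂ : Z ≤ W),
      resM F h₁ m = resM F h₂ m' := by
  refine ⟨fun h ↦ ?_, fun ⟨Z, h, h₁, h₂, e⟩ ↦ ?_⟩
  · obtain ⟨Z, hZ, i, j, e⟩ := F.presheaf.germ_eq _ hV hW m m' h
    exact ⟨Z, hZ, i.le, j.le, e⟩
  · rw [← genGermM_res h₁ h, e, genGermM_res]

lemma exists_resM_eq_zero {V : X.Opens} {hV : genericPoint X ∈ V} {m : Γ(F, V)}
    (h : genGermM F V hV m = 0) :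
    ∃ (Z : X.Opens) (_ : genericPoint X ∈ Z) (h₁ : Z ≤ V), resM F h₁ m = 0 := by
  rw [← map_zero (genGermM F V hV)] at h
  obtain ⟨Z, hZ, h₁, h₂, e⟩ := genGermM_eq_iff.mp h
  exact ⟨Z, hZ, h₁, by rw [e, map_zero]⟩

lemma genGerm_ne_zero {W : X.Opens} {f : Γ(X, W)} (h : genericPoint X ∈ X.basicOpen f)
    (hW : genericPoint X ∈ W) : genGerm W hW f ≠ 0 := by
  rw [← isUnit_iff_ne_zero]
  exact (X.mem_basicOpen f _ hW).mp h

/-- Generators over an affine open also span the stalk: a germ lives on some basic open, and a power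
of the equation extends it to the affine open. -/
lemma finiteDimensional_genStalk (k : Type u) [Field k] [X.Over (Spec (.of k))]
    [hqc : F.IsQuasicoherent]
    (hft : SheafOfModules.IsFiniteType.{u} F) :
    FiniteDimensional X.functionField (GenStalk F) := by
  obtain ⟨W, hW, hη, -, G, hG⟩ := exists_generatingSections_restrict F hft
    (TopologicalSpace.Opens.mem_top (genericPoint X))
  obtain ⟨s, hs⟩ := (finite_sections k hW F G).fg_top
  classical
  refine ⟨⟨s.image (genGermM F W hη), ?_⟩⟩
  rw [eq_top_iff]
  rintro ξ -
  have hmem : ∀ m : Γ(F, W), genGermM F W hη m ∈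
      Submodule.span X.functionField
        ((s.image (genGermM F W hη) : Finset _) : Set (GenStalk F)) := by
    intro m
    have hm : m ∈ Submodule.span Γ(X, W) (s : Set Γ(F, W)) := hs ▸ Submodule.mem_top
    induction hm using Submodule.span_induction with
    | mem x hx => exact Submodule.subset_span (by simpa using ⟨x, hx, rfl⟩)
    | zero => rw [map_zero]; exact zero_mem _
    | add x y _ _ hx hy => rw [map_add]; exact add_mem hx hy
    | smul a x _ hx => rw [genGermM_smul]; exact Submodule.smul_mem _ _ hx
  obtain ⟨V, hVW, hV, m, rfl⟩ := exists_genGermM_eq ξ hη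
  obtain ⟨f, hf, hηf⟩ := hW.exists_basicOpen_le ⟨_, hV⟩ hη
  obtain ⟨n, t, ht⟩ := exists_resM_eq_pow_smul k hW F f (resM F hf m)
  have h1 := congrArg (genGermM F _ hηf) ht
  rw [genGermM_res, genGermM_smul, genGermM_res, ← map_pow, genGerm_res, map_pow] at h1
  rw [← inv_smul_smul₀ (pow_ne_zero n (genGerm_ne_zero hηf hη)) (genGermM F V hV m)]
  refine Submodule.smul_mem _ _ ?_
  have h2 := hmem t
  rwa [h1] at h2

variable {k : Type u} [Field k] [X.Over (Spec (.of k))] [IsAlgClosed k] [CharZero k]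
  [Smooth (X ↘ Spec (.of k))]

/-- Infeq sheaves of finite type on smooth varieties have no torsion, over small affine open
sets. -/
lemma InfeqStructure.genGermM_eq_zero_of_finite [hqc : F.IsQuasicoherent] (S : InfeqStructure k F)
    {W : X.Opens} (hW : IsAffineOpen W) (hη : genericPoint X ∈ W)
    [Module.Finite Γ(X, W) Γ(F, W)] {m : Γ(F, W)} (hm : genGermM F W hη m = 0) : m = 0 := by
  have := smooth_sections k hW
  have : Nonempty W := ⟨⟨_, hη⟩⟩
  have : IsNoetherianRing Γ(X, W) := Algebra.FiniteType.isNoetherianRing k _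
  let T : Submodule Γ(X, W) Γ(F, W) :=
    { carrier := {m | genGermM F W hη m = 0}
      zero_mem' := map_zero _
      add_mem' := fun {a b} ha hb ↦ by
        rw [Set.mem_ofPred_eq] at *
        rw [map_add, ha, hb, add_zero]
      smul_mem' := fun a x hx ↦ by
        rw [Set.mem_ofPred_eq] at *
        rw [genGermM_smul, hx, smul_zero] }
  have hact : ∀ (D : Tangent k X W), ∀ t ∈ T, S.act W D t ∈ T := by
    intro D t ht
    obtain ⟨Z, hZ, h₁, e⟩ := exists_resM_eq_zero ht
    change genGermM F W hη _ = 0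
    rw [← genGermM_res h₁ hZ, ← S.act_res, e, map_zero, map_zero]
  have htors : Module.IsTorsion Γ(X, W) T := by
    rintro ⟨t, ht⟩
    obtain ⟨Z, hZ, h₁, e⟩ := exists_resM_eq_zero ht
    obtain ⟨f, hf, hηf⟩ := hW.exists_basicOpen_le ⟨_, hZ⟩ hη
    obtain ⟨n, hn⟩ := exists_pow_smul_eq_zero k hW F f t (by
      rw [← resM_resM F h₁ hf, e, map_zero])
    refine ⟨⟨f ^ n, mem_nonZeroDivisors_of_ne_zero (pow_ne_zero n ?_)⟩, Subtype.ext hn⟩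
    rintro rfl
    exact genGerm_ne_zero hηf hη (map_zero _)
  -- `T` is finitely generated by noetherianity, so a single nonzero function kills it.
  obtain ⟨b, hb, hb0⟩ := Submodule.annihilator_top_inter_nonZeroDivisors htors
  have hI := eq_top_of_derivation_stable (k := k) T.annihilator
    (fun h ↦ by
      have : b ∈ T.annihilator := by
        rw [Submodule.mem_annihilator]
        intro t ht
        exact congrArg Subtype.val (Submodule.mem_annihilator.mp hb ⟨t, ht⟩ trivial)
      rw [h, Ideal.mem_bot] at this
      exact nonZeroDivisors.ne_zero hb0 this)
    (fun D a ha ↦ by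
      rw [Submodule.mem_annihilator] at ha ⊢
      intro t ht
      obtain ⟨E, rfl⟩ := exists_tangent_deriv_eq k hW D
      -- Since `a` kills both `t` and `E t`, the Leibniz rule leaves `E(a) t = 0`.
      have h := S.leibniz W E a t
      rw [ha t ht, map_zero, ha _ (hact E t ht), add_zero] at h
      exact h.symm)
  have := Submodule.mem_annihilator.mp ((Ideal.eq_top_iff_one _).mp hI) m hm
  rwa [one_smul] at this

/-- Vanishing is local, and every point has an affine neighbourhood with finitely generated
sections. -/
theorem InfeqStructure.genGermM_injective [hqc : F.IsQuasicoherent]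
    (hft : SheafOfModules.IsFiniteType.{u} F) (S : InfeqStructure k F) {V : X.Opens}
    (hV : genericPoint X ∈ V) {m : Γ(F, V)} (hm : genGermM F V hV m = 0) : m = 0 := by
  choose W hW hxW hWV G hG using fun x : V ↦ exists_generatingSections_restrict F hft x.2
  refine TopCat.Sheaf.eq_of_locally_eq' ⟨F.presheaf, F.isSheaf⟩ W V (fun x ↦ homOfLE (hWV x))
    (fun x hx ↦ TopologicalSpace.Opens.mem_iSup.mpr ⟨⟨x, hx⟩, hxW _⟩) m 0 fun x ↦ ?_
  have := finite_sections k (hW x) F (G x)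
  have h0 : resM F (hWV x) m = 0 :=
    S.genGermM_eq_zero_of_finite (hW x) (genericPoint_mem (hxW x)) (by rw [genGermM_res, hm])
  exact h0.trans (map_zero (resM F (hWV x))).symm

end GenericStalk

/-! ### Calculus of vector fields -/

section Restriction

variable {k : Type u} [Field k] {X : Scheme.{u}} [X.Over (Spec (.of k))] {U V : X.Opens}

lemma Tangent.smul_res (h : V ≤ U) (a : Γ(X, U)) (D : Tangent k X U) :
    (a • D).res h = resO (k := k) h a • D.res h := by
  ext1
  funext W hW
  change resO (k := k) _ a • D.app W _ = resO (k := k) _ (resO (k := k) _ a) • D.app W _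
  rw [← resO_trans]

lemma resO_self (a : Γ(X, U)) : resO (k := k) le_rfl a = a :=
  congrArg (fun φ ↦ φ a) (X.presheaf.map_id (op U))

lemma Tangent.deriv_smul (a b : Γ(X, U)) (D : Tangent k X U) :
    (a • D).deriv b = a * D.deriv b := by
  change resO (k := k) le_rfl a * D.deriv b = _
  rw [resO_self]

lemma Tangent.lie_smul_smul (a b : Γ(X, U)) (D : Tangent k X U) :
    ⁅a • D, b • D⁆ = (a * D.deriv b - b * D.deriv a) • D := by
  ext1
  funext V h
  ext c
  simp only [Tangent.lie_app, Tangent.smul_app, Derivation.commutator_apply, Derivation.smul_apply,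
    smul_eq_mul, Derivation.leibniz, map_sub, map_mul, D.app_res le_rfl h, Tangent.deriv]
  ring

lemma Tangent.res_deriv (h : V ≤ U) (D : Tangent k X U) (a : Γ(X, U)) :
    (D.res h).deriv (resO (k := k) h a) = resO (k := k) h (D.deriv a) :=
  D.app_res le_rfl h a

lemma charZero_functionField (k : Type u) [Field k] [CharZero k] (X : Scheme.{u})
    [X.Over (Spec (.of k))] [IsIntegral X] : CharZero X.functionField :=
  charZero_of_injective_ringHom
    ((genGerm ⊤ (TopologicalSpace.Opens.mem_top (genericPoint X))).comp
      (algebraMap k Γ(X, ⊤))).injective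

end Restriction

/-! ### Vector fields acting on the generic stalk -/

section StalkOperators

variable {k : Type u} [Field k] {X : Scheme.{u}} [X.Over (Spec (.of k))] [IsIntegral X]
  {F : X.Modules} (S : InfeqStructure k F) {U V : X.Opens}

namespace InfeqStructure

lemma genGermM_act_congr (D : Tangent k X U) {V W : X.Opens} (hV : V ≤ U) (hW : W ≤ U)
    {h : genericPoint X ∈ V} {h' : genericPoint X ∈ W} {m : Γ(F, V)} {m' : Γ(F, W)}
    (e : genGermM F V h m = genGermM F W h' m') :
    genGermM F V h (S.act V (D.res hV) m) = genGermM F W h' (S.act W (D.res hW) m') := by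
  obtain ⟨Z, hZ, h₁, h₂, e⟩ := genGermM_eq_iff.mp e
  refine genGermM_eq_iff.mpr ⟨Z, hZ, h₁, h₂, ?_⟩
  rw [← S.act_res, ← S.act_res, e]
  rfl

/-- The action commutes with restriction, so the germ of the result depends only on the germ of the
section. -/
lemma exists_stalkOp (hU : genericPoint X ∈ U) (D : Tangent k X U) (ξ : GenStalk F) :
    ∃ ζ : GenStalk F, ∀ (V : X.Opens) (hV : V ≤ U) (h : genericPoint X ∈ V) (m : Γ(F, V)),
      genGermM F V h m = ξ → genGermM F V h (S.act V (D.res hV) m) = ζ := by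
  obtain ⟨W, hW, h, m, rfl⟩ := exists_genGermM_eq ξ hU
  exact ⟨_, fun V hV h m hm ↦ S.genGermM_act_congr D hV hW hm⟩

/-- The action of a vector field on the stalk at the generic point. -/
def stalkOp (hU : genericPoint X ∈ U) (D : Tangent k X U) : Module.End ℤ (GenStalk F) :=
  AddMonoidHom.toIntLinearMap <| AddMonoidHom.mk' (fun ξ ↦ (S.exists_stalkOp hU D ξ).choose) <| by
    intro ξ ζ
    obtain ⟨V, hV, h, m, rfl⟩ := exists_genGermM_eq ξ hU
    obtain ⟨W, hW, h', m', rfl⟩ := exists_genGermM_eq ζ h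
    rw [← genGermM_res hW h' m, ← map_add,
      ← (S.exists_stalkOp hU D _).choose_spec W (hW.trans hV) h' _ rfl,
      ← (S.exists_stalkOp hU D _).choose_spec W (hW.trans hV) h' _ rfl,
      ← (S.exists_stalkOp hU D _).choose_spec W (hW.trans hV) h' _ rfl, map_add, map_add]

lemma stalkOp_genGermM (hU : genericPoint X ∈ U) (D : Tangent k X U) (hV : V ≤ U)
    (h : genericPoint X ∈ V) (m : Γ(F, V)) :
    S.stalkOp hU D (genGermM F V h m) = genGermM F V h (S.act V (D.res hV) m) :=
  ((S.exists_stalkOp hU D _).choose_spec V hV h m rfl).symm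

lemma stalkOp_add (hU : genericPoint X ∈ U) (D E : Tangent k X U) :
    S.stalkOp hU (D + E) = S.stalkOp hU D + S.stalkOp hU E := by
  ext ξ
  obtain ⟨V, hV, h, m, rfl⟩ := exists_genGermM_eq ξ hU
  have : (D + E).res hV = D.res hV + E.res hV := rfl
  rw [LinearMap.add_apply, stalkOp_genGermM _ _ _ hV, stalkOp_genGermM _ _ _ hV,
    stalkOp_genGermM _ _ _ hV, this, map_add, LinearMap.add_apply, map_add]

lemma stalkOp_lie (hU : genericPoint X ∈ U) (D E : Tangent k X U) :
    S.stalkOp hU ⁅D, E⁆ = S.stalkOp hU D * S.stalkOp hU E - S.stalkOp hU E * S.stalkOp hU D := by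
  ext ξ
  obtain ⟨V, hV, h, m, rfl⟩ := exists_genGermM_eq ξ hU
  have : ⁅D, E⁆.res hV = ⁅D.res hV, E.res hV⁆ := rfl
  rw [LinearMap.sub_apply, Module.End.mul_apply, Module.End.mul_apply,
    stalkOp_genGermM _ _ _ hV, stalkOp_genGermM _ _ _ hV, stalkOp_genGermM _ _ _ hV,
    stalkOp_genGermM _ _ _ hV, stalkOp_genGermM _ _ _ hV, this, S.act_lie, map_sub]

lemma stalkOp_res (hU : genericPoint X ∈ U) (hV : V ≤ U) (h : genericPoint X ∈ V)
    (D : Tangent k X U) : S.stalkOp h (D.res hV) = S.stalkOp hU D := by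
  ext ξ
  obtain ⟨W, hW, h, m, rfl⟩ := exists_genGermM_eq ξ h
  rw [stalkOp_genGermM _ _ _ hW, stalkOp_genGermM _ _ _ (hW.trans hV)]
  rfl

lemma stalkOp_smul (hU : genericPoint X ∈ U) (D : Tangent k X U) (a : Γ(X, U))
    (ξ : GenStalk F) : S.stalkOp hU D (genGerm U hU a • ξ) =
      genGerm U hU (D.deriv a) • ξ + genGerm U hU a • S.stalkOp hU D ξ := by
  obtain ⟨V, hV, h, m, rfl⟩ := exists_genGermM_eq ξ hU
  rw [← genGerm_res k hV h a, ← genGerm_res k hV h (D.deriv a), ← genGermM_smul,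
    stalkOp_genGermM _ _ _ hV, S.leibniz, Tangent.res_deriv, map_add, genGermM_smul, genGermM_smul,
    stalkOp_genGermM _ _ _ hV]

open TensorProduct

/-- The family of operators `a ↦ a D` on the stalk at the generic point, linearly extended to the
functions `K ⊗ Γ(X, U)` over the function field `K`. -/
def stalkOps [Nonempty U] (D : Tangent k X U) :
    X.functionField ⊗[ℤ] Γ(X, U) →ₗ[X.functionField] Module.End ℤ (GenStalk F) :=
  extendOps <| AddMonoidHom.mk'
    (fun a ↦ S.stalkOp (genericPoint_mem (Classical.arbitrary U).2) (a • D)) fun a b ↦ by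
      rw [add_smul, stalkOp_add]

lemma stalkOps_tmul [Nonempty U] (hU : genericPoint X ∈ U) (D : Tangent k X U)
    (c : X.functionField) (a : Γ(X, U)) :
    S.stalkOps D (c ⊗ₜ a) = c • S.stalkOp hU (a • D) := rfl

lemma stalkOps_smul [Nonempty U] (D : Tangent k X U) (a : Γ(X, U))
    (b : X.functionField ⊗[ℤ] Γ(X, U)) :
    S.stalkOps (a • D) b = S.stalkOps D (b * 1 ⊗ₜ a) := by
  have hU := genericPoint_mem (Classical.arbitrary U).2
  induction b with
  | zero => simp
  | add b c hb hc => rw [map_add, hb, hc, add_mul, map_add]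
  | tmul c x =>
    rw [Algebra.TensorProduct.tmul_mul_tmul, stalkOps_tmul _ hU, stalkOps_tmul _ hU, mul_one,
      smul_smul]

/-- Restriction of functions over the function field. -/
def resBC (k : Type u) [Field k] [X.Over (Spec (.of k))] (h : V ≤ U) :
    X.functionField ⊗[ℤ] Γ(X, U) →ₐ[X.functionField] X.functionField ⊗[ℤ] Γ(X, V) :=
  Algebra.TensorProduct.map (AlgHom.id _ _) (resO (k := k) h : Γ(X, U) →+* Γ(X, V)).toIntAlgHom

lemma resBC_tmul (h : V ≤ U) (c : X.functionField) (a : Γ(X, U)) :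
    resBC k h (c ⊗ₜ a) = c ⊗ₜ resO (k := k) h a := rfl

lemma resBC_diag [Nonempty U] [Nonempty V] (h : V ≤ U) (a : Γ(X, U)) :
    resBC k h (diag X.functionField a) = diag X.functionField (resO (k := k) h a) := by
  have hV := genericPoint_mem (Classical.arbitrary V).2
  rw [diag, map_sub, resBC_tmul, resBC_tmul, map_one]
  exact congrArg (fun c ↦ _ - c ⊗ₜ[ℤ] 1) (genGerm_res k h hV a).symm

lemma stalkOps_res [Nonempty U] [Nonempty V] (h : V ≤ U) (D : Tangent k X U)
    (b : X.functionField ⊗[ℤ] Γ(X, U)) :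
    S.stalkOps (D.res h) (resBC k h b) = S.stalkOps D b := by
  have hV := genericPoint_mem (Classical.arbitrary V).2
  induction b with
  | zero => simp
  | add b c hb hc => rw [map_add, map_add, hb, hc, map_add]
  | tmul c x =>
    rw [resBC_tmul, stalkOps_tmul _ hV, stalkOps_tmul _ (h hV), ← Tangent.smul_res, stalkOp_res]

variable [CharZero k] [FiniteDimensional X.functionField (GenStalk F)]

/-- With `v` inverse to `D f`, the field `v D` sends `f` to 1. Writing `D = (D f) (v D)` costs only
a factor `1 ⊗ D f`, which the arbitrary `b` of `extendOps_diag_pow_mul` absorbs. -/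
lemma stalkOps_diag_pow_of_isUnit [Nonempty U] (hU : IsAffineOpen U) (D : Tangent k X U)
    (f : Γ(X, U)) (hf : IsUnit (D.deriv f)) :
    S.stalkOps D (diag X.functionField f ^ (rank F ^ 2 + 1)) = 0 := by
  have hη := genericPoint_mem (Classical.arbitrary U).2
  have := charZero_functionField k X
  have := functionField_isFractionRing_of_isAffineOpen X U hU
  obtain ⟨v, hv⟩ := hf.exists_right_inv
  have hD : D.deriv f • v • D = D := by rw [smul_smul, hv, one_smul]
  let δ : Derivation ℤ Γ(X, U) Γ(X, U) := Derivation.mk'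
    ((v • D).deriv : Γ(X, U) →ₗ[k] Γ(X, U)).toAddMonoidHom.toIntLinearMap (v • D).deriv.leibniz
  have hδ : ∀ a, δ a = (v • D).deriv a := fun _ ↦ rfl
  rw [← hD, stalkOps_smul]
  refine extendOps_diag_pow_mul δ _ (fun a b m ↦ ?_) (fun a b ↦ ?_) ?_ _
  · refine (S.stalkOp_smul hη (a • v • D) b m).trans ?_
    rw [Tangent.deriv_smul]
    rfl
  · change S.stalkOp hη _ = S.stalkOp hη _ * S.stalkOp hη _ - S.stalkOp hη _ * S.stalkOp hη _
    rw [← stalkOp_lie, Tangent.lie_smul_smul]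
    rfl
  · rw [hδ, Tangent.deriv_smul, mul_comm, hv]

/-- The operators on the generic stalk do not change under restriction, so `U` may be replaced by an
affine open on which `D f` is invertible. -/
lemma stalkOps_diag_pow_of_ne_zero [Nonempty U] (D : Tangent k X U) (f : Γ(X, U))
    (hf : D.deriv f ≠ 0) : S.stalkOps D (diag X.functionField f ^ (rank F ^ 2 + 1)) = 0 := by
  have hη := genericPoint_mem (Classical.arbitrary U).2
  have hb : genericPoint X ∈ X.basicOpen (D.deriv f) := by
    refine (X.mem_basicOpen _ _ hη).mpr (isUnit_iff_ne_zero.mpr ?_)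
    exact (map_ne_zero_iff _ (genGerm_injective U hη)).mpr hf
  obtain ⟨W, hW, hηW, hWb⟩ := exists_isAffineOpen_mem_and_subset hb
  have hWU : W ≤ U := hWb.trans (X.basicOpen_le _)
  have : Nonempty W := ⟨⟨_, hηW⟩⟩
  rw [← S.stalkOps_res hWU, map_pow, resBC_diag]
  refine S.stalkOps_diag_pow_of_isUnit hW _ _ ?_
  rw [Tangent.res_deriv, resO_trans hWb (X.basicOpen_le _)]
  exact (X.toRingedSpace.isUnit_res_basicOpen (D.deriv f)).map (resO (k := k) hWb)

lemma stalkOps_diag_pow [Nonempty U] (D : Tangent k X U) (f : Γ(X, U)) :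
    S.stalkOps D (diag X.functionField f ^ (rank F ^ 2 + 1)) = 0 := by
  have := charZero_functionField k X
  have hη := genericPoint_mem (Classical.arbitrary U).2
  by_cases hD : ∀ (V : X.Opens) (hV : V ≤ U) (y : Γ(X, V)), D.app V hV y = 0
  · have : D = 0 := by
      ext1
      funext V hV
      exact Derivation.ext (hD V hV)
    have h0 : S.stalkOps (0 : Tangent k X U) = 0 := by
      refine LinearMap.ext fun b ↦ ?_
      rw [← zero_smul Γ(X, U) (0 : Tangent k X U), stalkOps_smul, tmul_zero, mul_zero, map_zero,
        LinearMap.zero_apply]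
    rw [this, h0, LinearMap.zero_apply]
  -- A nonzero `D` may kill every function on `U`; a function `y` with nonzero derivative is taken
  -- on a smaller `V`.
  · push Not at hD
    obtain ⟨V, hV, y, hy⟩ := hD
    have hηV : genericPoint X ∈ V := by
      by_contra h
      exact hy (ext_genGerm fun h' ↦ absurd h' h)
    have : Nonempty V := ⟨⟨_, hηV⟩⟩
    rw [← S.stalkOps_res hV, map_pow, resBC_diag]
    set g := resO (k := k) hV f
    have hy : (D.res hV).deriv y ≠ 0 := hy
    -- `D g + c D y` vanishes for at most one `c`; the constant coefficient of the expansion in `c`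
    -- is then the power of `diag g`.
    have hS : {c : ℕ | (D.res hV).deriv (g + (c : Γ(X, V)) * y) ≠ 0}.Infinite := by
      have : {c : ℕ | (D.res hV).deriv (g + (c : Γ(X, V)) * y) ≠ 0}ᶜ.Subsingleton := by
        intro c hc c' hc'
        simp only [Set.mem_compl_iff, Set.mem_ofPred_eq, not_not, map_add, Derivation.leibniz,
          Derivation.map_natCast, smul_eq_mul, mul_zero, add_zero] at hc hc'
        have h := mul_right_cancel₀ hy (add_left_cancel (hc.trans hc'.symm))
        have h := congrArg (genGerm V hηV) h
        rw [map_natCast, map_natCast] at h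
        exact Nat.cast_injective h
      exact this.finite.infinite_compl.mono (by rw [compl_compl])
    have := map_diag_pow_eq_zero (S.stalkOps (D.res hV)) (rank F ^ 2 + 1) g y hS
      (fun c hc ↦ S.stalkOps_diag_pow_of_ne_zero _ _ hc) (Nat.zero_le _)
    rwa [pow_zero, one_mul, Nat.sub_zero] at this

lemma stalkOps_diag_prod [Nonempty U] (D : Tangent k X U) (l : List Γ(X, U))
    (hl : l.length = rank F ^ 2 + 1) : S.stalkOps D (l.map (diag X.functionField)).prod = 0 :=
  have := charZero_functionField k X
  map_diag_prod_eq_zero _ _ (S.stalkOps_diag_pow D) l hl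

end InfeqStructure

end StalkOperators

/-! ### Iterated commutators of the Lie map -/

section Conclusion

variable {k : Type u} [Field k] {X : Scheme.{u}} [X.Over (Spec (.of k))] [IsIntegral X]
  {F : X.Modules} (S : InfeqStructure k F) {U : X.Opens}

open TensorProduct

/-- The operator `T` is induced by an element `b` of `K ⊗ Γ(X, U)`, and multiplies the symbol by
`s`. -/
structure InfeqStructure.Represents [Nonempty U] (T : Tangent k X U →ₗ[k] Atiyah k F U)
    (b : X.functionField ⊗[ℤ] Γ(X, U)) (s : Γ(X, U)) : Prop where
  anchor (D : Tangent k X U) : (T D).anchor = s • D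
  app (D : Tangent k X U) (V : X.Opens) (hV : V ≤ U) (h : genericPoint X ∈ V) (m : Γ(F, V)) :
    genGermM F V h ((T D).app V hV m) = S.stalkOps D b (genGermM F V h m)

namespace InfeqStructure

variable {S}

lemma represents_lieMap [Nonempty U] :
    S.Represents (S.lieMap U : Tangent k X U →ₗ[k] Atiyah k F U) 1 1 where
  anchor D := (one_smul _ D).symm
  app D V hV h m := by
    rw [Algebra.TensorProduct.one_def, stalkOps_tmul _ (hV h), one_smul, one_smul,
      stalkOp_genGermM _ _ _ hV]
    rfl

/-- Precomposing with `a` multiplies `b` by `1 ⊗ a`, postcomposing by `a ⊗ 1`. The symbol of any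
commutator is zero because the symbol of `T` is `𝒪`-linear. -/
lemma Represents.commutator [Nonempty U] {T : Tangent k X U →ₗ[k] Atiyah k F U}
    {b : X.functionField ⊗[ℤ] Γ(X, U)} {s : Γ(X, U)} (hT : S.Represents T b s) (a : Γ(X, U)) :
    S.Represents (Infeq.commutator T a) (b * diag X.functionField a) 0 where
  anchor D := by
    change (T (a • D)).anchor - a • (T D).anchor = _
    rw [hT.anchor, hT.anchor, smul_comm, sub_self, zero_smul]
  app D V hV h m := by
    change genGermM F V h ((T (a • D)).app V hV m - resO (k := k) hV a • (T D).app V hV m) = _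
    have : diag X.functionField a = 1 ⊗ₜ a - genGerm U (hV h) a • 1 := by
      rw [diag, Algebra.TensorProduct.one_def, TensorProduct.smul_tmul', smul_eq_mul, mul_one]
      rfl
    rw [map_sub, genGermM_smul, hT.app, hT.app, genGerm_res, stalkOps_smul, this, mul_sub,
      map_sub, mul_smul_comm, mul_one, map_smul]
    rfl

lemma Represents.isDiffOp [Nonempty U]
    (hinj : ∀ (V : X.Opens) (h : genericPoint X ∈ V), Function.Injective (genGermM F V h))
    (n : ℕ) {T : Tangent k X U →ₗ[k] Atiyah k F U}
    {b : X.functionField ⊗[ℤ] Γ(X, U)} {s : Γ(X, U)} (hT : S.Represents T b s)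
    (hb : ∀ (D : Tangent k X U) (l : List Γ(X, U)), l.length = n + 1 →
      S.stalkOps D (b * (l.map (diag X.functionField)).prod) = 0) :
    IsDiffOp (A := Γ(X, U)) n T := by
  induction n generalizing T b s with
  | zero =>
    intro a D
    rw [← sub_eq_zero]
    have hc := hT.commutator a
    refine Atiyah.ext' ((hc.anchor D).trans (zero_smul _ D)) fun V hV m ↦ ?_
    by_cases h : genericPoint X ∈ V
    · refine hinj V h ((hc.app D V hV h m).trans ?_)
      have := hb D [a] rfl
      rw [List.map_singleton, List.prod_singleton] at this
      rw [this, LinearMap.zero_apply]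
      exact (map_zero _).symm
    -- An open set missing the generic point is empty, and its sections form a module over the zero
    -- ring.
    · have : V = ⊥ := by
        ext x
        simpa using fun hx ↦ h (genericPoint_mem hx)
      subst this
      have := Module.subsingleton Γ(X, ⊥) Γ(F, ⊥)
      exact Subsingleton.elim _ _
  | succ n ih =>
    intro a
    refine ih (hT.commutator a) fun D l hl ↦ ?_
    have := hb D (a :: l) (by simp [hl])
    rwa [List.map_cons, List.prod_cons, ← mul_assoc] at this

lemma isDiffOp_of_subsingleton {k A M N : Type*} [CommRing k] [CommRing A] [Algebra k A]
    [AddCommGroup M] [Module k M] [Module A M] [IsScalarTower k A M]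
    [AddCommGroup N] [Module k N] [Module A N] [IsScalarTower k A N] [Subsingleton N] (n : ℕ)
    (T : M →ₗ[k] N) : IsDiffOp (A := A) n T := by
  induction n generalizing T with
  | zero => exact fun _ _ ↦ Subsingleton.elim _ _
  | succ n ih => exact fun _ ↦ ih _

end InfeqStructure

end Conclusion

end Infeq

/-- The Lie map of a coherent infeq sheaf on a smooth variety over an algebraically closed field of
characteristic zero is a differential operator of order at most the square of the rank. -/
theorem theorem2 (k : Type u) [Field k] [IsAlgClosed k] [CharZero k]
    (X : Scheme.{u}) [X.Over (Spec (.of k))]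
    [IsIntegral X] [IsSeparated (X ↘ Spec (.of k))] [QuasiCompact (X ↘ Spec (.of k))]
    [Smooth (X ↘ Spec (.of k))]
    (F : X.Modules) (hqc : F.IsQuasicoherent) (hft : SheafOfModules.IsFiniteType.{u} F)
    (S : Infeq.InfeqStructure k F) :
    S.LieMapIsDiffOp (Infeq.rank F ^ 2) := by
  intro U
  rcases isEmpty_or_nonempty U with hU | hU
  · have : Subsingleton Γ(X, U) := by
      have : U = ⊥ := by
        ext x
        simpa using fun hx ↦ hU.false ⟨x, hx⟩
      subst this
      infer_instance
    have : Subsingleton (Infeq.Atiyah k F U) := Module.subsingleton Γ(X, U) _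
    exact Infeq.InfeqStructure.isDiffOp_of_subsingleton _ _
  · have := Infeq.finiteDimensional_genStalk k hft
    refine Infeq.InfeqStructure.represents_lieMap.isDiffOp (fun V h ↦ ?_) _ fun D l hl ↦ ?_
    · exact (injective_iff_map_eq_zero _).mpr fun m hm ↦ S.genGermM_injective hft h hm
    · rw [one_mul, S.stalkOps_diag_prod D l hl]

end
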